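/- All hypergraphs are finite and have no repeated hyperedges. Let $k\ge 3$, $m\ge 3$ and $0<\alpha<1$. A hypergraph is $k$-uniform if every hyperedge has exactly $k$ vertices, linear if any two distinct hyperedges share at most one vertex, and unicyclic if it is connected and contains exactly one cycle (a cycle is an alternating cyclic sequence $v_1e_1v_2e_2\cdots v_\ell e_\ell v_1$, $\ell\ge 2$, of distinct vertices and distinct hyperedges with $v_i,v_{i+1}\in e_i$; starting point and direction are disregarded). The $k$-uniform hypercycle $C_m^{(k)}$ has vertices $u_i$ and $w_{i,j}$ ($i\in\mathbb{Z}/m$, $1\le j\le k-2$), all distinct, and hyperedges $e_i=\{u_i,w_{i,1},\dots,w_{i,k-2},u_{i+1}\}$, $i\in\mathbb{Z}/m$. For a $k$-uniform hypergraph $\mathcal H$ on $n$ vertices put $\mathcal A_\alpha(\mathcal H)=\alpha\mathcal D(\mathcal H)+(1-\alpha)\mathcal A(\mathcal H)$, where $\mathcal D(\mathcal H)$ is the order-$k$ diagonal tensor of vertex degrees and $\mathcal A(\mathcal H)$ is the adjacency tensor, with entry $\frac1{(k-1)!}$ at $(i_1,\dots,i_k)$ if $\{i_1,\dots,i_k\}$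 is a hyperedge and $0$ otherwise. The $d$-th order trace of an order-$k$, $n$-dimensional tensor $\mathcal T$ is $$\mathrm{Tr}_d(\mathcal T)=(k-1)^{n-1}\sum_{d_1+\cdots+d_n=d}\ \prod_{i=1}^n\frac{1}{(d_i(k-1))!}\Bigl(\sum_{(i_2,\dots,i_k)\in[n]^{k-1}}\mathcal T_{i i_2\cdots i_k}\frac{\partial}{\partial a_{ii_2}}\cdots\frac{\partial}{\partial a_{ii_k}}\Bigr)^{d_i}\mathrm{tr}\bigl(A^{d(k-1)}\bigr),$$ where the $d_i$ are nonnegative integers and $A=(a_{ij})$ is an $n\times n$ matrix of variables. For $k$-uniform hypergraphs $\mathcal H_1,\mathcal H_2$ with the same number $n$ of vertices, write $\mathcal H_1\prec_\alpha\mathcal H_2$ if there is an integer $d$ with $1\le d\le n(k-1)^{n-1}-1$ such that $\mathrm{Tr}_t(\mathcal A_\alpha(\mathcal H_1))=\mathrm{Tr}_t(\mathcal A_\alpha(\mathcal H_2))$ for $0\le t<d$ and $\mathrm{Tr}_d(\mathcal A_\alpha(\mathcal H_1))<\mathrm{Tr}_d(\mathcal A_\alpha(\mathcal H_2))$; write $\mathcal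 H_1=_\alpha\mathcal H_2$ if these traces agree for all $0\le t\le n(k-1)^{n-1}-1$; and write $\mathcal H_1\preceq_\alpha\mathcal H_2$ if $\mathcal H_1\prec_\alpha\mathcal H_2$ or $\mathcal H_1=_\alpha\mathcal H_2$. **Theorem.** The hypercycle $C_m^{(k)}$ is the first hypergraph in $S_\alpha$-order among all $k$-uniform linear unicyclic hypergraphs with $m$ hyperedges. That is, $C_m^{(k)}$ is a $k$-uniform linear unicyclic hypergraph with $m$ hyperedges, and every $k$-uniform linear unicyclic hypergraph $\mathcal H$ with $m$ hyperedges has the same number of vertices as $C_m^{(k)}$ and satisfies $C_m^{(k)}\preceq_\alpha\mathcal H$, with $C_m^{(k)}=_\alpha\mathcal H$ if and only if $\mathcal H$ is isomorphic to $C_m^{(k)}$. -/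

import Mathlib

open scoped Nat

/-! ### Tensors and their traces -/

/-- Real tensors of order `k` with index set `ι`. The entry with indices `i, i₂, …, i_k` is written
`T i a`, where `a = (i₂, …, i_k)`. -/
abbrev RTensor (ι : Type*) (k : ℕ) : Type _ := ι → (Fin (k - 1) → ι) → ℝ

namespace RTensor

variable {ι : Type*}

/-- The partial derivative `∂/∂a_{ij}` acting on polynomials in the entries of an auxiliary
matrix `(a_{ij})`. -/
noncomputable def partialD (i j : ι) : Module.End ℝ (MvPolynomial (ι × ι) ℝ) :=
  (MvPolynomial.pderiv (i, j)).toLinearMap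

theorem partialD_commute (i j i' j' : ι) : Commute (partialD i j) (partialD i' j') := by
  have h : ⁅MvPolynomial.pderiv (R := ℝ) (i, j), MvPolynomial.pderiv (R := ℝ) (i', j')⁆ = 0 := by
    classical
    refine MvPolynomial.derivation_ext fun x => ?_
    simp [Derivation.commutator_apply, MvPolynomial.pderiv_X, Pi.single_apply, apply_ite]
  refine LinearMap.ext fun p => ?_
  have := congrArg (fun D => D p) h
  simpa [partialD, Derivation.commutator_apply, sub_eq_zero] using this

/-- `∂/∂a_{i a} = ∂/∂a_{i i₂} ⋯ ∂/∂a_{i i_k}` for `a = (i₂, …, i_k)`. -/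
noncomputable def multiPartial {k : ℕ} (i : ι) (a : Fin (k - 1) → ι) :
    Module.End ℝ (MvPolynomial (ι × ι) ℝ) :=
  Finset.univ.noncommProd (fun j => partialD i (a j))
    (fun _ _ _ _ _ => partialD_commute _ _ _ _)

theorem multiPartial_commute {k : ℕ} (i i' : ι) (a a' : Fin (k - 1) → ι) :
    Commute (multiPartial i a) (multiPartial i' a') :=
  Finset.noncommProd_commute _ _ _ _ fun _ _ =>
    (Finset.noncommProd_commute _ _ _ _ fun _ _ => partialD_commute _ _ _ _).symm

variable [Fintype ι] {k : ℕ}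

/-- The operator `∑_a T_{i a} ∂/∂a_{i a}`, the sum over all `a ∈ ι ^ (k - 1)`. -/
noncomputable def rowOperator (T : RTensor ι k) (i : ι) :
    Module.End ℝ (MvPolynomial (ι × ι) ℝ) :=
  ∑ a : Fin (k - 1) → ι, T i a • multiPartial i a

theorem rowOperator_commute (T : RTensor ι k) (i i' : ι) :
    Commute (rowOperator T i) (rowOperator T i') :=
  Commute.sum_left _ _ _ fun _ _ => Commute.sum_right _ _ _ fun _ _ =>
    ((multiPartial_commute _ _ _ _).smul_left _).smul_right _

variable [DecidableEq ι]

/-- The polynomial `tr (A ^ N)`, where `A = (a_{ij})` is the auxiliary matrix of variables. -/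
noncomputable def auxTrace (ι : Type*) [Fintype ι] [DecidableEq ι] (N : ℕ) :
    MvPolynomial (ι × ι) ℝ :=
  (Matrix.mvPolynomialX ι ι ℝ ^ N).trace

/-- The `d`-th order trace of a tensor of order `k` and dimension `n`,
`(k-1)^(n-1) ∑_{d₁+⋯+d_n=d} ∏_i (1/(d_i(k-1))!) (∑_a T_{i a} ∂/∂a_{i a})^{d_i} tr (A^{d(k-1)})`.
The operators are homogeneous of total order `d (k - 1)`, so the result is a constant polynomial;
`MvPolynomial.constantCoeff` reads it as a real number. -/
noncomputable def trace (T : RTensor ι k) (d : ℕ) : ℝ :=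
  ((k : ℝ) - 1) ^ (Fintype.card ι - 1) *
    ∑ D ∈ Finset.piAntidiag (Finset.univ : Finset ι) d,
      (∏ i, (1 / ((D i * (k - 1))! : ℝ))) *
        MvPolynomial.constantCoeff
          (Finset.univ.noncommProd (fun i => rowOperator T i ^ D i)
            (fun _ _ _ _ _ => (rowOperator_commute T _ _).pow_pow _ _)
            (auxTrace ι (d * (k - 1))))

end RTensor

/-! ### Hypergraphs -/

namespace Hypergraph

variable {β β₁ β₂ : Type*}

/-- Every hyperedge has exactly `k` vertices. -/
def IsUniform (H : Hypergraph β) (k : ℕ) : Prop := ∀ e ∈ H.edgeSet, e.ncard = k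

/-- Two different hyperedges have at most one common vertex. -/
def IsLinear (H : Hypergraph β) : Prop :=
  ∀ e ∈ H.edgeSet, ∀ f ∈ H.edgeSet, e ≠ f → (e ∩ f).Subsingleton

/-- The bipartite incidence graph: `v` and `e` are adjacent when `v ∈ e`. -/
def incidenceGraph (H : Hypergraph β) : SimpleGraph (H.vertexSet ⊕ H.edgeSet) :=
  SimpleGraph.fromRel fun x y =>
    ∃ (v : H.vertexSet) (e : H.edgeSet), x = Sum.inl v ∧ y = Sum.inr e ∧ (v : β) ∈ (e : Set β)

/-- A hypergraph is connected if it has a vertex and any two of its vertices are joined by a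
sequence `v₀ e₁ v₁ e₂ ⋯ e_l v_l` with `v_{i-1}, v_i ∈ e_i`. -/
def IsConnected (H : Hypergraph β) : Prop :=
  H.vertexSet.Nonempty ∧
    ∀ u v : H.vertexSet, H.incidenceGraph.Reachable (Sum.inl u) (Sum.inl v)

/-- Connected with exactly one cycle. A cycle `v₁ e₁ v₂ e₂ ⋯ v_l e_l v₁` of a hypergraph (`l ≥ 2`,
distinct vertices, distinct hyperedges, `v_i, v_{i+1} ∈ e_i`) is a cycle of its incidence graph;
passing to the subgraph identifies cycles that differ by the starting point or the direction. -/
def IsUnicyclic (H : Hypergraph β) : Prop :=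
  H.IsConnected ∧
    ∃! C : H.incidenceGraph.Subgraph,
      ∃ (x : H.vertexSet ⊕ H.edgeSet) (c : H.incidenceGraph.Walk x x),
        c.IsCycle ∧ c.toSubgraph = C

/-- `k`-uniform linear unicyclic hypergraphs with `m` hyperedges. -/
structure IsLinearUnicyclic (H : Hypergraph β) (k m : ℕ) : Prop where
  uniform : H.IsUniform k
  linear : H.IsLinear
  unicyclic : H.IsUnicyclic
  ncard_edgeSet : H.edgeSet.ncard = m

/-- Isomorphism of hypergraphs: a bijection of the vertex sets that carries hyperedges to hyperedges
in both directions. -/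
def IsIsomorphic (H₁ : Hypergraph β₁) (H₂ : Hypergraph β₂) : Prop :=
  ∃ ψ : H₁.vertexSet ≃ H₂.vertexSet, ∀ e : Set H₁.vertexSet,
    Subtype.val '' e ∈ H₁.edgeSet ↔ Subtype.val '' (ψ '' e) ∈ H₂.edgeSet

/-- The `k`-uniform hypercycle with `m` hyperedges (`k ≥ 2`, `m ≥ 3`). The vertices are
`u_i = inl i` and `w_{i,j} = inr (i, j)`, where `i` is taken modulo `m` and `j` runs over `k - 2`
values; the hyperedges are `e_i = {u_i, u_{i+1}} ∪ {w_{i,j} | j}`. -/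
def hypercycle (k m : ℕ) : Hypergraph (Fin m ⊕ Fin m × Fin (k - 2)) where
  vertexSet := Set.univ
  edgeSet := Set.range fun i : Fin m =>
    {x | x = Sum.inl i ∨ x = Sum.inl (finRotate m i) ∨ ∃ j, x = Sum.inr (i, j)}
  subset_vertexSet_of_mem_edgeSet' := fun _ _ => Set.subset_univ _

instance (k m : ℕ) : Fintype (hypercycle k m).vertexSet :=
  inferInstanceAs (Fintype (Set.univ : Set (Fin m ⊕ Fin m × Fin (k - 2))))

/-- The degree of a vertex: the number of hyperedges that contain it. -/
noncomputable def degree (H : Hypergraph β) (v : β) : ℕ := {e ∈ H.edgeSet | v ∈ e}.ncard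

open Classical in
/-- The adjacency tensor of a `k`-uniform hypergraph. -/
noncomputable def adjacencyTensor (H : Hypergraph β) (k : ℕ) : RTensor H.vertexSet k :=
  fun i a =>
    if insert (i : β) (Set.range fun j => (a j : β)) ∈ H.edgeSet then 1 / ((k - 1)! : ℝ) else 0

open Classical in
/-- The diagonal tensor of vertex degrees. -/
noncomputable def degreeTensor (H : Hypergraph β) (k : ℕ) : RTensor H.vertexSet k :=
  fun i a => if ∀ j, a j = i then (H.degree i : ℝ) else 0

/-- The tensor `A_α = α D + (1 - α) A`. -/
noncomputable def alphaTensor (H : Hypergraph β) (k : ℕ) (α : ℝ) : RTensor H.vertexSet k :=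
  α • H.degreeTensor k + (1 - α) • H.adjacencyTensor k

open Classical in
/-- The `d`-th order spectral moment of the tensor `A_α`, that is, its `d`-th order trace. -/
noncomputable def alphaMoment (H : Hypergraph β) [Fintype H.vertexSet] (k : ℕ) (α : ℝ) (d : ℕ) : ℝ :=
  (H.alphaTensor k α).trace d

/-- `H₁` comes before `H₂` in `S_α`-order: both have `n` vertices, and for some
`1 ≤ d ≤ n (k - 1) ^ (n - 1) - 1` the moments of orders `0, …, d - 1` agree, and the `d`-th order
moment of `H₁` is smaller than that of `H₂`. -/
def AlphaBefore (k : ℕ) (α : ℝ) (H₁ : Hypergraph β₁) (H₂ : Hypergraph β₂)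
    [Fintype H₁.vertexSet] [Fintype H₂.vertexSet] : Prop :=
  Fintype.card H₁.vertexSet = Fintype.card H₂.vertexSet ∧
    ∃ d ∈ Set.Icc 1
        (Fintype.card H₁.vertexSet * (k - 1) ^ (Fintype.card H₁.vertexSet - 1) - 1),
      (∀ t < d, H₁.alphaMoment k α t = H₂.alphaMoment k α t) ∧
        H₁.alphaMoment k α d < H₂.alphaMoment k α d

/-- `H₁ =_α H₂`: both have `n` vertices, and their moments of orders
`0, …, n (k - 1) ^ (n - 1) - 1` agree. -/
def AlphaEq (k : ℕ) (α : ℝ) (H₁ : Hypergraph β₁) (H₂ : Hypergraph β₂)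
    [Fintype H₁.vertexSet] [Fintype H₂.vertexSet] : Prop :=
  Fintype.card H₁.vertexSet = Fintype.card H₂.vertexSet ∧
    ∀ t < Fintype.card H₁.vertexSet * (k - 1) ^ (Fintype.card H₁.vertexSet - 1),
      H₁.alphaMoment k α t = H₂.alphaMoment k α t

/-- `H₁ ≼_α H₂`. -/
def AlphaBeforeOrEq (k : ℕ) (α : ℝ) (H₁ : Hypergraph β₁) (H₂ : Hypergraph β₂)
    [Fintype H₁.vertexSet] [Fintype H₂.vertexSet] : Prop :=
  AlphaBefore k α H₁ H₂ ∨ AlphaEq k α H₁ H₂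

end Hypergraph

/-! The differential operators in `trace` have constant coefficients, so Tr_d is the apolar pairing
of tr(A^N), N = d(k-1), with products of row polynomials. Expanding such a product means choosing `D
i` terms in each row i, each of them a loop or a hyperedge through i, that is, k-1 arcs leaving i.
The coefficient of a monomial in tr(A^N) counts the rooted closed walks with that arc multiset, so
it vanishes unless the arcs are balanced and connected.

Balance at v makes k divide the number of uses of hyperedges through v. In a linear hypergraph and
for d ≤ k+2 this leaves two kinds of choice (`eq_loopChoice_or_edgeChoice`,
`pairing_loops_ne_zero`): loops at one vertex, or one hyperedge used once in each of its rows
together with d-k loops at its vertices. The weights are invariant under relabelling, which gives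
`exists_trace_formula`: Tr_d is κ_d Σ deg^d for 0 < d < k; the orders k and k+1 add multiples of |E|
and of Σ_e Σ_{v∈e} deg v; the order k+2 adds a multiple of Σ_e Σ_{v∈e} deg(v)² and B Σ_e (Σ_{v∈e}
deg v)². Here κ_d and B are positive.

Unicyclicity fixes the number n = m(k-1) of vertices, and the degree sum is mk. Hence Tr_2 is
minimal exactly when all degrees are 1 or 2, because (x-1)(x-2) ≥ 0 at positive integers. In that
case all power sums of the degrees agree with those of the hypercycle, so the traces first can
differ at order k+2, in the B-term. The degree sums of the hyperedges have fixed mean k+2, so the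
B-term is minimal exactly when each of them equals k+2 (`trace_familyTensor_lt_or`). Every hyperedge
then has just two vertices of degree 2. The cycle of the hypergraph uses these up, so nothing else
can be attached to it, and connectedness leaves only the hypercycle
(`IsLinearUnicyclic.isIsomorphic_hypercycle`). -/

/-! ### Traces of tensors as values of a linear functional on polynomials -/

namespace RTensor

open MvPolynomial

section Pairing

variable {σ τ : Type*} [Fintype σ] [Fintype τ]

/-- The apolar pairing of a polynomial with `Q`: on monomials it is `X^M ↦ M! · coeff M Q`. -/
noncomputable def pairing (Q : MvPolynomial σ ℝ) : MvPolynomial σ ℝ →ₗ[ℝ] ℝ :=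
  (basisMonomials σ ℝ).constr ℝ fun M => (∏ x, ((M x)! : ℝ)) * coeff M Q

theorem pairing_monomial (Q : MvPolynomial σ ℝ) (M : σ →₀ ℕ) :
    pairing Q (monomial M 1) = (∏ x, ((M x)! : ℝ)) * coeff M Q := by
  have := (basisMonomials σ ℝ).constr_basis ℝ
    (fun M => (∏ x, ((M x)! : ℝ)) * coeff M Q) M
  rwa [coe_basisMonomials] at this

theorem pairing_one (Q : MvPolynomial σ ℝ) : pairing Q 1 = constantCoeff Q := by
  have := pairing_monomial Q 0
  simpa [constantCoeff_eq] using this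

/-- Differentiation is adjoint to multiplication by the variable: the coefficient of M in the
derivative carries the factor M s + 1, which is also the quotient of the two factorial products. -/
theorem pairing_pderiv (s : σ) (P Q : MvPolynomial σ ℝ) :
    pairing (pderiv s Q) P = pairing Q (P * X s) := by
  classical
  have : pairing (pderiv s Q) = pairing Q ∘ₗ LinearMap.mulRight ℝ (X s) := by
    refine (basisMonomials σ ℝ).ext fun M => ?_
    have h : monomial M (1 : ℝ) * X s = monomial (M + Finsupp.single s 1) 1 := by
      rw [X, monomial_mul, one_mul]
    simp only [coe_basisMonomials, LinearMap.comp_apply, LinearMap.mulRight_apply, h,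
      pairing_monomial, coeff_pderiv]
    have h2 : ∏ x, (((M + Finsupp.single s 1 : σ →₀ ℕ) x)! : ℝ)
        = (∏ x, ((M x)! : ℝ)) * (M s + 1) := by
      rw [← Finset.mul_prod_erase _ _ (Finset.mem_univ s),
        ← Finset.mul_prod_erase _ (fun x => ((M x)! : ℝ)) (Finset.mem_univ s)]
      have : ∏ x ∈ Finset.univ.erase s, (((M + Finsupp.single s 1 : σ →₀ ℕ) x)! : ℝ)
          = ∏ x ∈ Finset.univ.erase s, ((M x)! : ℝ) := by
        refine Finset.prod_congr rfl fun x hx => ?_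
        simp [(Finset.ne_of_mem_erase hx).symm]
      rw [this]
      simp [Nat.factorial_succ]
      ring
    rw [h2]
    ring
  rw [this]
  rfl

theorem pairing_rename (f : σ ≃ τ) (P Q : MvPolynomial σ ℝ) :
    pairing (rename f Q) (rename f P) = pairing Q P := by
  have : pairing (rename f Q) ∘ₗ (rename f).toLinearMap = pairing Q := by
    refine (basisMonomials σ ℝ).ext fun M => ?_
    simp only [coe_basisMonomials, LinearMap.comp_apply, AlgHom.toLinearMap_apply,
      rename_monomial, pairing_monomial, coeff_rename_mapDomain _ f.injective]
    congr 1
    rw [← f.prod_comp]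
    simp [Finsupp.mapDomain_apply f.injective]
  rw [← this]
  rfl

/-- The operator `O` acts as the differential operator with symbol `P`. -/
def HasSymbol (O : Module.End ℝ (MvPolynomial σ ℝ)) (P : MvPolynomial σ ℝ) : Prop :=
  ∀ Q R, pairing (O Q) R = pairing Q (R * P)

theorem pairing_add (Q R P : MvPolynomial σ ℝ) :
    pairing (Q + R) P = pairing Q P + pairing R P := by
  have : pairing (Q + R) = pairing Q + pairing R := by
    refine (basisMonomials σ ℝ).ext fun M => ?_
    simp only [coe_basisMonomials, LinearMap.add_apply, pairing_monomial, coeff_add, mul_add]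
  rw [this]
  rfl

theorem pairing_smul (c : ℝ) (Q P : MvPolynomial σ ℝ) :
    pairing (c • Q) P = c * pairing Q P := by
  have : pairing (c • Q) = c • pairing Q := by
    refine (basisMonomials σ ℝ).ext fun M => ?_
    simp only [coe_basisMonomials, LinearMap.smul_apply, pairing_monomial, coeff_smul, smul_eq_mul]
    ring
  rw [this]
  rfl

theorem pairing_zero (P : MvPolynomial σ ℝ) : pairing 0 P = 0 := by
  simpa using pairing_smul 0 0 P

theorem HasSymbol.one : HasSymbol (1 : Module.End ℝ (MvPolynomial σ ℝ)) 1 := by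
  intro Q R
  simp

theorem HasSymbol.mul {O O' : Module.End ℝ (MvPolynomial σ ℝ)} {P P' : MvPolynomial σ ℝ}
    (h : HasSymbol O P) (h' : HasSymbol O' P') : HasSymbol (O * O') (P * P') := by
  intro Q R
  rw [Module.End.mul_apply, h, h', mul_assoc]

theorem HasSymbol.pow {O : Module.End ℝ (MvPolynomial σ ℝ)} {P : MvPolynomial σ ℝ}
    (h : HasSymbol O P) (n : ℕ) : HasSymbol (O ^ n) (P ^ n) := by
  induction n with
  | zero => simpa using HasSymbol.one
  | succ n ih => simpa only [pow_succ] using ih.mul h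

theorem HasSymbol.smul {O : Module.End ℝ (MvPolynomial σ ℝ)} {P : MvPolynomial σ ℝ}
    (h : HasSymbol O P) (c : ℝ) : HasSymbol (c • O) (c • P) := by
  intro Q R
  rw [LinearMap.smul_apply, pairing_smul, h, mul_smul_comm, map_smul, smul_eq_mul]

theorem HasSymbol.sum {κ : Type*} (s : Finset κ) {O : κ → Module.End ℝ (MvPolynomial σ ℝ)}
    {P : κ → MvPolynomial σ ℝ} (h : ∀ i ∈ s, HasSymbol (O i) (P i)) :
    HasSymbol (∑ i ∈ s, O i) (∑ i ∈ s, P i) := by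
  classical
  induction s using Finset.induction_on with
  | empty => intro Q R; simp [pairing_zero]
  | insert a s ha ih =>
    intro Q R
    rw [Finset.sum_insert ha, Finset.sum_insert ha, LinearMap.add_apply, pairing_add,
      h a (Finset.mem_insert_self a s), ih fun i hi => h i (Finset.mem_insert_of_mem hi), mul_add,
      map_add]

theorem HasSymbol.noncommProd {κ : Type*} (s : Finset κ)
    {O : κ → Module.End ℝ (MvPolynomial σ ℝ)} {P : κ → MvPolynomial σ ℝ} (comm)
    (h : ∀ i ∈ s, HasSymbol (O i) (P i)) : HasSymbol (s.noncommProd O comm) (∏ i ∈ s, P i) := by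
  classical
  induction s using Finset.induction_on with
  | empty => simpa using HasSymbol.one
  | insert a s ha ih =>
    rw [Finset.noncommProd_insert_of_notMem _ _ _ _ ha, Finset.prod_insert ha]
    exact (h a (Finset.mem_insert_self a s)).mul
      (ih _ fun i hi => h i (Finset.mem_insert_of_mem hi))

end Pairing

variable {ι κ : Type*} [Fintype ι] [Fintype κ] {k : ℕ}

/-- The symbol of the operator `∑_a T_{i a} ∂/∂a_{i a}`. -/
noncomputable def rowPoly (T : RTensor ι k) (i : ι) : MvPolynomial (ι × ι) ℝ :=
  ∑ a : Fin (k - 1) → ι, T i a • ∏ j, X (i, a j)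

theorem hasSymbol_rowOperator (T : RTensor ι k) (i : ι) :
    HasSymbol (rowOperator T i) (rowPoly T i) :=
  HasSymbol.sum _ fun _ _ => HasSymbol.smul
    (HasSymbol.noncommProd _ _ fun _ _ _ _ => pairing_pderiv _ _ _) _

variable [DecidableEq ι] [DecidableEq κ]

/-- The constant coefficient is the pairing with 1, and each operator moves across the pairing as
its symbol, so the product of operators becomes a product of polynomials. -/
theorem trace_eq_sum_pairing (T : RTensor ι k) (d : ℕ) :
    T.trace d = ((k : ℝ) - 1) ^ (Fintype.card ι - 1) *
      ∑ D ∈ Finset.piAntidiag (Finset.univ : Finset ι) d,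
        (∏ i, (1 / ((D i * (k - 1))! : ℝ))) *
          pairing (auxTrace ι (d * (k - 1))) (∏ i, rowPoly T i ^ D i) := by
  unfold trace
  congr 1
  refine Finset.sum_congr rfl fun D _ => ?_
  congr 1
  rw [← pairing_one]
  exact (HasSymbol.noncommProd _ _ (fun i _ => (hasSymbol_rowOperator T i).pow (D i)) _ _).trans
    (by rw [one_mul])

theorem rename_auxTrace (f : ι ≃ κ) (N : ℕ) :
    rename (f.prodCongr f) (auxTrace ι N) = auxTrace κ N := by
  have h : (rename (f.prodCongr f)).toRingHom.mapMatrix (Matrix.mvPolynomialX ι ι ℝ)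
      = (Matrix.mvPolynomialX κ κ ℝ).submatrix f f := by
    ext i j : 2
    simp [Matrix.mvPolynomialX_apply]
  have h2 := congrArg (fun A => Matrix.trace (A ^ N)) h
  simp only [← map_pow] at h2
  rw [auxTrace, auxTrace]
  have h3 : (Matrix.mvPolynomialX κ κ ℝ).submatrix f f ^ N
      = (Matrix.mvPolynomialX κ κ ℝ ^ N).submatrix f f := by
    have := map_pow (Matrix.reindexAlgEquiv ℝ (MvPolynomial (κ × κ) ℝ) f.symm)
      (Matrix.mvPolynomialX κ κ ℝ) N
    simpa [Matrix.coe_reindexAlgEquiv] using this.symm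
  rw [h3] at h2
  simp only [Matrix.trace, map_sum, Matrix.diag_apply, Matrix.submatrix_apply] at h2 ⊢
  rw [f.sum_comp (fun i => (Matrix.mvPolynomialX κ κ ℝ ^ N) i i)] at h2
  rw [← h2]
  rfl

omit [DecidableEq ι] [DecidableEq κ] in
theorem rename_rowPoly (f : ι ≃ κ) (T : RTensor κ k) (i : ι) :
    rename (f.prodCongr f) (rowPoly (fun i a => T (f i) (f ∘ a)) i) = rowPoly T (f i) := by
  simp only [rowPoly, map_sum, map_smul, map_prod, rename_X, Equiv.prodCongr_apply, Prod.map]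
  rw [← (Equiv.arrowCongr (Equiv.refl (Fin (k - 1))) f).sum_comp]
  rfl

/-- Used both for the equality of moments of isomorphic hypergraphs and for carrying two hypergraphs
to a common vertex set before their traces are compared. -/
theorem trace_reindex (f : ι ≃ κ) (T : RTensor κ k) (d : ℕ) :
    trace (fun i a => T (f i) (f ∘ a) : RTensor ι k) d = trace T d := by
  rw [trace_eq_sum_pairing, trace_eq_sum_pairing, Fintype.card_congr f]
  congr 1
  refine Finset.sum_nbij' (fun D => D ∘ f.symm) (fun D => D ∘ f) ?_ ?_ ?_ ?_ ?_
  · intro D hD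
    simp only [Finset.mem_piAntidiag, Finset.mem_univ, implies_true, and_true] at hD ⊢
    rw [← hD, ← f.symm.sum_comp]
    rfl
  · intro D hD
    simp only [Finset.mem_piAntidiag, Finset.mem_univ, implies_true, and_true] at hD ⊢
    rw [← hD, ← f.sum_comp]
    rfl
  · intro D _; ext; simp
  · intro D _; ext; simp
  · intro D _
    congr 1
    · rw [← f.prod_comp]
      simp
    · rw [← rename_auxTrace f, ← pairing_rename (f.prodCongr f)]
      congr 1
      rw [map_prod, ← f.prod_comp]
      refine Finset.prod_congr rfl fun i _ => ?_
      rw [map_pow, rename_rowPoly]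
      simp

end RTensor

/-! ### The monomials of the trace of a power of the generic matrix -/

namespace RTensor

open MvPolynomial Finsupp

variable {ι : Type*} [Fintype ι] [DecidableEq ι]

/-- The generic matrix with real coefficients. -/
local notation "𝕏" => Matrix.mvPolynomialX ι ι ℝ

/-- The coefficient of M in `(𝕏 ^ N) i j` counts the walks of length N from i to j with arc multiset
M. The recursion removes the last arc; the facts about walks below are inductions on it. -/
theorem coeff_pow_succ (N : ℕ) (i j : ι) (M : ι × ι →₀ ℕ) :
    coeff M ((𝕏 ^ (N + 1)) i j) =
      ∑ l, if M (l, j) = 0 then 0 else coeff (M - single (l, j) 1) ((𝕏 ^ N) i l) := by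
  rw [pow_succ, Matrix.mul_apply, coeff_sum]
  refine Finset.sum_congr rfl fun l _ => ?_
  rw [Matrix.mvPolynomialX_apply, coeff_mul_X']
  simp only [Finsupp.mem_support_iff, ite_not]

theorem coeff_pow_nonneg (N : ℕ) (i j : ι) (M : ι × ι →₀ ℕ) : 0 ≤ coeff M ((𝕏 ^ N) i j) := by
  induction N generalizing j M with
  | zero =>
    rw [pow_zero, Matrix.one_apply]
    split_ifs
    · rw [coeff_one]; split_ifs <;> norm_num
    · simp
  | succ N ih =>
    rw [coeff_pow_succ]
    refine Finset.sum_nonneg fun l _ => ?_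
    split_ifs
    exacts [le_rfl, ih _ _]

theorem exists_of_coeff_pow_succ_ne_zero {N : ℕ} {i j : ι} {M : ι × ι →₀ ℕ}
    (h : coeff M ((𝕏 ^ (N + 1)) i j) ≠ 0) :
    ∃ l M', M = M' + single (l, j) 1 ∧ coeff M' ((𝕏 ^ N) i l) ≠ 0 := by
  rw [coeff_pow_succ] at h
  obtain ⟨l, -, hl⟩ := Finset.exists_ne_zero_of_sum_ne_zero h
  split_ifs at hl with h0
  · exact absurd rfl hl
  · refine ⟨l, _, ?_, hl⟩
    rw [tsub_add_cancel_of_le]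
    rw [Finsupp.single_le_iff]
    omega

theorem eq_of_coeff_pow_zero_ne_zero {i j : ι} {M : ι × ι →₀ ℕ}
    (h : coeff M ((𝕏 ^ 0) i j) ≠ 0) : i = j ∧ M = 0 := by
  rw [pow_zero, Matrix.one_apply] at h
  split_ifs at h with hij
  · rw [coeff_one] at h
    split_ifs at h with h0
    · exact ⟨hij, h0.symm⟩
    · exact absurd rfl h
  · simp at h

theorem degree_of_coeff_pow_ne_zero {N : ℕ} {i j : ι} {M : ι × ι →₀ ℕ}
    (h : coeff M ((𝕏 ^ N) i j) ≠ 0) : ∑ x, M x = N := by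
  induction N generalizing j M with
  | zero => simp [(eq_of_coeff_pow_zero_ne_zero h).2]
  | succ N ih =>
    obtain ⟨l, M', rfl, h'⟩ := exists_of_coeff_pow_succ_ne_zero h
    simp [Finset.sum_add_distrib, ih h', Finsupp.single_apply]

/-- A walk leaves every vertex as often as it enters it, up to one extra departure at its start and
one extra arrival at its end; the two indicators correct for these. -/
theorem balanced_of_coeff_pow_ne_zero {N : ℕ} {i j : ι} {M : ι × ι →₀ ℕ}
    (h : coeff M ((𝕏 ^ N) i j) ≠ 0) (v : ι) :
    ∑ l, M (v, l) + (if j = v then 1 else 0) = ∑ l, M (l, v) + (if i = v then 1 else 0) := by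
  induction N generalizing j M with
  | zero => obtain ⟨rfl, rfl⟩ := eq_of_coeff_pow_zero_ne_zero h; simp
  | succ N ih =>
    obtain ⟨l, M', rfl, h'⟩ := exists_of_coeff_pow_succ_ne_zero h
    have := ih h'
    have h1 : ∑ x, single (l, j) 1 (v, x) = if l = v then 1 else 0 := by
      by_cases hl : l = v <;> simp [Finsupp.single_apply, hl]
    have h2 : ∑ x, single (l, j) 1 (x, v) = if j = v then 1 else 0 := by
      by_cases hl : j = v <;> simp [Finsupp.single_apply, hl]
    simp only [Finsupp.add_apply, Finset.sum_add_distrib, h1, h2]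
    omega

/-- A walk none of whose arcs crosses the boundary of S stays on the side where it starts. This is
the form in which connectedness of the arc multiset is used. -/
theorem mem_iff_of_coeff_pow_ne_zero {N : ℕ} {i j : ι} {M : ι × ι →₀ ℕ} (S : Set ι)
    (hM : ∀ x y, M (x, y) ≠ 0 → (x ∈ S ↔ y ∈ S)) (h : coeff M ((𝕏 ^ N) i j) ≠ 0) :
    (i ∈ S ↔ j ∈ S) ∧ ∀ x y, M (x, y) ≠ 0 → (x ∈ S ↔ i ∈ S) := by
  induction N generalizing j M with
  | zero => obtain ⟨rfl, rfl⟩ := eq_of_coeff_pow_zero_ne_zero h; simp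
  | succ N ih =>
    obtain ⟨l, M', rfl, h'⟩ := exists_of_coeff_pow_succ_ne_zero h
    obtain ⟨h1, h2⟩ := ih (fun x y hxy => hM x y (by simp [hxy])) h'
    have hlj := hM l j (by simp)
    refine ⟨h1.trans hlj, fun x y hxy => ?_⟩
    by_cases hx : M' (x, y) = 0
    · have : (l, j) = (x, y) := by
        by_contra hne
        simp [hx, hne] at hxy
      obtain ⟨rfl, rfl⟩ := Prod.mk.inj this
      exact h1.symm
    · exact h2 x y hx

theorem balanced_of_coeff_auxTrace_ne_zero {N : ℕ} {M : ι × ι →₀ ℕ}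
    (h : coeff M (auxTrace ι N) ≠ 0) (v : ι) : ∑ l, M (v, l) = ∑ l, M (l, v) := by
  rw [auxTrace, Matrix.trace, coeff_sum] at h
  obtain ⟨i, -, hi⟩ := Finset.exists_ne_zero_of_sum_ne_zero h
  simpa using balanced_of_coeff_pow_ne_zero hi v

theorem subset_or_subset_compl_of_coeff_auxTrace_ne_zero {N : ℕ} {M : ι × ι →₀ ℕ} (S : Set ι)
    (hM : ∀ x y, M (x, y) ≠ 0 → (x ∈ S ↔ y ∈ S)) (h : coeff M (auxTrace ι N) ≠ 0) :
    (∀ x y, M (x, y) ≠ 0 → x ∈ S) ∨ ∀ x y, M (x, y) ≠ 0 → x ∉ S := by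
  rw [auxTrace, Matrix.trace, coeff_sum] at h
  obtain ⟨i, -, hi⟩ := Finset.exists_ne_zero_of_sum_ne_zero h
  have := (mem_iff_of_coeff_pow_ne_zero S hM hi).2
  by_cases hiS : i ∈ S
  · exact Or.inl fun x y hxy => (this x y hxy).2 hiS
  · exact Or.inr fun x y hxy hx => hiS ((this x y hxy).1 hx)

/-- `M` is the arc multiset of a walk from `i` to `j`. -/
def IsArcWalk (i j : ι) (M : ι × ι →₀ ℕ) : Prop := ∃ N, 0 < coeff M ((𝕏 ^ N) i j)

theorem IsArcWalk.nil (i : ι) : IsArcWalk i i 0 := ⟨0, by simp⟩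

theorem IsArcWalk.arc (i j : ι) : IsArcWalk i j (single (i, j) 1) :=
  ⟨1, by simp [Matrix.mvPolynomialX_apply, coeff_X]⟩

theorem IsArcWalk.add {i j l : ι} {M M' : ι × ι →₀ ℕ} (h : IsArcWalk i j M)
    (h' : IsArcWalk j l M') : IsArcWalk i l (M + M') := by
  obtain ⟨N, hN⟩ := h
  obtain ⟨N', hN'⟩ := h'
  refine ⟨N + N', ?_⟩
  rw [pow_add, Matrix.mul_apply, coeff_sum]
  refine Finset.sum_pos' (fun x _ => ?_) ⟨j, Finset.mem_univ _, ?_⟩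
  · rw [coeff_mul]
    exact Finset.sum_nonneg fun p _ =>
      mul_nonneg (coeff_pow_nonneg _ _ _ _) (coeff_pow_nonneg _ _ _ _)
  · rw [coeff_mul]
    exact Finset.sum_pos' (fun p _ =>
      mul_nonneg (coeff_pow_nonneg _ _ _ _) (coeff_pow_nonneg _ _ _ _))
      ⟨(M, M'), by simp, mul_pos hN hN'⟩

theorem IsArcWalk.sum {κ : Type*} (s : Finset κ) {i : ι} {M : κ → ι × ι →₀ ℕ}
    (h : ∀ x ∈ s, IsArcWalk i i (M x)) : IsArcWalk i i (∑ x ∈ s, M x) := by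
  classical
  induction s using Finset.induction_on with
  | empty => simpa using IsArcWalk.nil i
  | insert a s ha ih =>
    rw [Finset.sum_insert ha]
    exact (h a (Finset.mem_insert_self a s)).add
      (ih fun x hx => h x (Finset.mem_insert_of_mem hx))

theorem IsArcWalk.loops (i : ι) (n : ℕ) : IsArcWalk i i (single (i, i) n) := by
  induction n with
  | zero => simpa using IsArcWalk.nil i
  | succ n ih => rw [Finsupp.single_add]; exact ih.add (IsArcWalk.arc i i)

/-- All coefficients are nonnegative, so one closed walk suffices for positivity; walks never have
to be counted exactly. -/
theorem IsArcWalk.coeff_auxTrace_pos {i : ι} {M : ι × ι →₀ ℕ} (h : IsArcWalk i i M) {N : ℕ}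
    (hN : ∑ x, M x = N) : 0 < coeff M (auxTrace ι N) := by
  obtain ⟨N', h'⟩ := h
  obtain rfl : N' = N := (degree_of_coeff_pow_ne_zero h'.ne').symm.trans hN
  rw [auxTrace, Matrix.trace, coeff_sum]
  exact Finset.sum_pos' (fun x _ => coeff_pow_nonneg _ _ _ _) ⟨i, Finset.mem_univ _, h'⟩

omit [Fintype ι] in
/-- The arcs of the complete digraph on `s`, with `l i` loops at each `i ∈ s`. -/
noncomputable def completeArcs (s : Finset ι) (l : ι → ℕ) : ι × ι →₀ ℕ :=
  ∑ i ∈ s, (single (i, i) (l i) + ∑ j ∈ s.erase i, single (i, j) 1)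

omit [Fintype ι] in
theorem completeArcs_insert {s : Finset ι} {x : ι} (hx : x ∉ s) (l : ι → ℕ) :
    completeArcs (insert x s) l = completeArcs s l +
      (single (x, x) (l x) + ∑ j ∈ s, (single (x, j) 1 + single (j, x) 1)) := by
  rw [completeArcs, Finset.sum_insert hx, Finset.erase_insert hx, completeArcs]
  have : ∀ i ∈ s, single (i, i) (l i) + ∑ j ∈ (insert x s).erase i, single (i, j) 1
      = single (i, i) (l i) + ∑ j ∈ s.erase i, single (i, j) 1 + single (i, x) 1 := by
    intro i hi
    have hxi : x ≠ i := fun h => hx (h ▸ hi)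
    rw [Finset.erase_insert_of_ne hxi, Finset.sum_insert (fun h => hx (Finset.mem_of_mem_erase h))]
    abel
  rw [Finset.sum_congr rfl this, Finset.sum_add_distrib (f := fun i => _ + _),
    Finset.sum_add_distrib (s := s) (f := fun j => single (x, j) 1)]
  abel

/-- An Eulerian tour built by adding one vertex x at a time: go from b to x, run through the loops
at x, make a round trip from x to each earlier vertex other than b, and return to b. -/
theorem isArcWalk_completeArcs {s : Finset ι} {b : ι} (hb : b ∈ s) (l : ι → ℕ) :
    IsArcWalk b b (completeArcs s l) := by
  obtain ⟨t, hbt, rfl⟩ : ∃ t : Finset ι, b ∉ t ∧ insert b t = s :=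
    ⟨s.erase b, s.notMem_erase b, Finset.insert_erase hb⟩
  clear hb
  induction t using Finset.induction_on with
  | empty => simpa [completeArcs] using IsArcWalk.loops b (l b)
  | insert x t hx ih =>
    have hbt' : b ∉ t := fun h => hbt (Finset.mem_insert_of_mem h)
    have hxb : x ≠ b := fun h => hbt (h ▸ Finset.mem_insert_self _ _)
    rw [Finset.insert_comm, completeArcs_insert (by simp [hxb, hx]), Finset.sum_insert hbt']
    have h1 : IsArcWalk x x
        (single (x, x) (l x) + ∑ j ∈ t, (single (x, j) 1 + single (j, x) 1)) :=
      (IsArcWalk.loops x (l x)).add (IsArcWalk.sum _ fun j _ =>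
        (IsArcWalk.arc x j).add (IsArcWalk.arc j x))
    have h2 := (ih hbt').add (((IsArcWalk.arc b x).add h1).add (IsArcWalk.arc x b))
    convert h2 using 2
    abel

end RTensor

/-! ### The tensor of a finite family of hyperedges -/

namespace RTensor

open MvPolynomial
open Finsupp (single)

variable {ι : Type*} [Fintype ι] [DecidableEq ι]

/-- The number of members of `E` that contain `i`. -/
def familyDegree (E : Finset (Finset ι)) (i : ι) : ℕ := (E.filter fun e => i ∈ e).card

/-- The tensor `α D + (1 - α) A` of a family `E` of hyperedges. -/
noncomputable def familyTensor (E : Finset (Finset ι)) (k : ℕ) (α : ℝ) : RTensor ι k := fun i a =>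
  α * (if ∀ j, a j = i then (familyDegree E i : ℝ) else 0) +
    (1 - α) * (if insert i (Finset.univ.image a) ∈ E then 1 / ((k - 1)! : ℝ) else 0)

/-- The coefficient of the term of the `i`-th row that belongs to a loop (`none`) or a hyperedge. -/
noncomputable def termCoeff (E : Finset (Finset ι)) (α : ℝ) (i : ι) : Option (Finset ι) → ℝ
  | none => α * familyDegree E i
  | some e => if e ∈ E ∧ i ∈ e then 1 - α else 0

omit [Fintype ι] in
/-- The exponent of the term of the `i`-th row that belongs to a loop (`none`) or a hyperedge. -/
noncomputable def termArcs (k : ℕ) (i : ι) : Option (Finset ι) → (ι × ι →₀ ℕ)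
  | none => single (i, i) (k - 1)
  | some e => ∑ j ∈ e.erase i, single (i, j) 1

/-- Since e has k elements, the k - 1 entries must enumerate e without i, each element once. This
number of orderings cancels the 1/(k-1)! of the adjacency tensor in `rowPoly_familyTensor`. -/
theorem card_filter_insert_image_eq {k : ℕ} {e : Finset ι} {i : ι} (hk : 1 ≤ k) (he : e.card = k)
    (hi : i ∈ e) :
    (Finset.univ.filter fun a : Fin (k - 1) → ι => insert i (Finset.univ.image a) = e).card
      = (k - 1)! := by
  have hcard : Fintype.card (Fin (k - 1)) = Fintype.card (e.erase i) := by
    rw [Fintype.card_fin, Fintype.card_coe, Finset.card_erase_of_mem hi, he]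
  trans (Finset.univ : Finset (Fin (k - 1) ≃ e.erase i)).card
  swap
  · rw [Finset.card_univ, Fintype.card_equiv (Fintype.equivOfCardEq hcard), Fintype.card_fin]
  symm
  refine Finset.card_bij (fun f _ j => (f j : ι)) ?_ ?_ ?_
  · intro f _
    simp only [Finset.mem_filter, Finset.mem_univ, true_and]
    refine Eq.trans (congrArg (insert i) ?_) (Finset.insert_erase hi)
    ext x
    simp only [Finset.mem_image, Finset.mem_univ, true_and]
    exact ⟨fun ⟨j, hj⟩ => hj ▸ (f j).2, fun hx => ⟨f.symm ⟨x, hx⟩, by simp⟩⟩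
  · intro f _ g _ hfg
    ext j
    exact congrFun hfg j
  · intro a ha
    simp only [Finset.mem_filter, Finset.mem_univ, true_and] at ha
    have hle : (Finset.univ.image a).card ≤ k - 1 := by
      simpa only [Finset.card_fin] using Finset.card_image_le (s := Finset.univ) (f := a)
    have hnot : i ∉ Finset.univ.image a := by
      intro h
      rw [Finset.insert_eq_of_mem h] at ha
      rw [ha] at hle
      omega
    have himg : Finset.univ.image a = e.erase i := by rw [← ha, Finset.erase_insert hnot]
    have hmem : ∀ j, a j ∈ e.erase i := fun j => by
      rw [← himg]; exact Finset.mem_image_of_mem _ (Finset.mem_univ j)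
    have hsurj : Function.Surjective (fun j => (⟨a j, hmem j⟩ : e.erase i)) := by
      rintro ⟨x, hx⟩
      rw [← himg, Finset.mem_image] at hx
      obtain ⟨j, -, rfl⟩ := hx
      exact ⟨j, rfl⟩
    exact ⟨Equiv.ofBijective _ ((Fintype.bijective_iff_surjective_and_card _).2 ⟨hsurj, hcard⟩),
      Finset.mem_univ _, rfl⟩

omit [Fintype ι] in
theorem prod_X_eq_of_insert_image_eq {k : ℕ} {e : Finset ι} {i : ι} (hk : 1 ≤ k) (he : e.card = k)
    {a : Fin (k - 1) → ι} (ha : insert i (Finset.univ.image a) = e) :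
    ∏ j, (X (i, a j) : MvPolynomial (ι × ι) ℝ) = monomial (termArcs k i (some e)) 1 := by
  have hle : (Finset.univ.image a).card ≤ k - 1 := by
    simpa only [Finset.card_fin] using Finset.card_image_le (s := Finset.univ) (f := a)
  have hnot : i ∉ Finset.univ.image a := by
    intro h
    rw [Finset.insert_eq_of_mem h] at ha
    rw [ha] at hle
    omega
  have himg : Finset.univ.image a = e.erase i := by rw [← ha, Finset.erase_insert hnot]
  have hinj : Function.Injective a := by
    refine Set.injOn_univ.1 ?_
    rw [← Finset.coe_univ]
    refine Finset.card_image_iff.1 ?_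
    rw [himg, Finset.card_erase_of_mem (by rw [← ha]; exact Finset.mem_insert_self _ _), he,
      Finset.card_fin]
  rw [termArcs, ← himg, Finset.sum_image fun x _ y _ h => hinj h, monomial_sum_one]
  rfl

theorem rowPoly_familyTensor {E : Finset (Finset ι)} {k : ℕ} (hk : 1 ≤ k)
    (hE : ∀ e ∈ E, e.card = k) (α : ℝ) (i : ι) :
    rowPoly (familyTensor E k α) i =
      ∑ o, termCoeff E α i o • (monomial (termArcs k i o) 1 : MvPolynomial (ι × ι) ℝ) := by
  rw [Fintype.sum_option]
  simp only [rowPoly, familyTensor, add_smul, Finset.sum_add_distrib]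
  congr 1
  · rw [Finset.sum_eq_single (fun _ => i)]
    · simp only [implies_true, if_true, termCoeff, termArcs]
      congr 1
      rw [Finset.prod_const, Finset.card_fin, X_pow_eq_monomial]
    · intro a _ ha
      rw [if_neg, mul_zero, zero_smul]
      exact fun h => ha (funext h)
    · simp
  · have h1 : ∀ a : Fin (k - 1) → ι,
        ((1 - α) * (if insert i (Finset.univ.image a) ∈ E then 1 / ((k - 1)! : ℝ) else 0)) •
          ∏ j, (X (i, a j) : MvPolynomial (ι × ι) ℝ) =
        ∑ e : Finset ι, if insert i (Finset.univ.image a) = e then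
          (termCoeff E α i (some e) / ((k - 1)! : ℝ)) •
            (monomial (termArcs k i (some e)) 1 : MvPolynomial (ι × ι) ℝ) else 0 := by
      intro a
      rw [Finset.sum_ite_eq, if_pos (Finset.mem_univ _)]
      by_cases h : insert i (Finset.univ.image a) ∈ E
      · rw [if_pos h, prod_X_eq_of_insert_image_eq hk (hE _ h) rfl]
        simp only [termCoeff, h, Finset.mem_insert_self, and_self, if_true]
        rw [mul_one_div]
      · simp [termCoeff, h]
    simp only [h1]
    rw [Finset.sum_comm]
    refine Finset.sum_congr rfl fun e _ => ?_
    rw [← Finset.sum_filter, Finset.sum_const]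
    by_cases h : e ∈ E ∧ i ∈ e
    · rw [card_filter_insert_image_eq hk (hE e h.1) h.2, ← Nat.cast_smul_eq_nsmul ℝ, smul_smul,
        mul_div_cancel₀]
      exact_mod_cast Nat.factorial_ne_zero _
    · simp [termCoeff, h]

/-- The exponent of a product of terms, the `o`-th term of row `i` being taken `Q i o` times. -/
noncomputable def productArcs (k : ℕ) (Q : ι → Option (Finset ι) → ℕ) : ι × ι →₀ ℕ :=
  ∑ i, ∑ o, Q i o • termArcs k i o

/-- The coefficient with which a product of terms occurs in a product of powers of rows. -/
noncomputable def productCoeff (E : Finset (Finset ι)) (α : ℝ) (Q : ι → Option (Finset ι) → ℕ) :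
    ℝ :=
  ∏ i, ((Nat.multinomial Finset.univ (Q i) : ℝ) * ∏ o, termCoeff E α i o ^ Q i o)

theorem prod_rowPoly_pow {E : Finset (Finset ι)} {k : ℕ} (hk : 1 ≤ k)
    (hE : ∀ e ∈ E, e.card = k) (α : ℝ) (D : ι → ℕ) :
    ∏ i, rowPoly (familyTensor E k α) i ^ D i =
      ∑ Q ∈ Fintype.piFinset fun i => Finset.piAntidiag Finset.univ (D i),
        productCoeff E α Q • (monomial (productArcs k Q) 1 : MvPolynomial (ι × ι) ℝ) := by
  simp only [rowPoly_familyTensor hk hE, Finset.sum_pow_eq_sum_piAntidiag]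
  rw [Finset.prod_univ_sum]
  refine Finset.sum_congr rfl fun Q _ => ?_
  rw [productCoeff, productArcs, monomial_sum_one, ← Finset.prod_smul]
  refine Finset.prod_congr rfl fun i _ => ?_
  rw [monomial_sum_one, mul_smul, Nat.cast_smul_eq_nsmul, nsmul_eq_mul, ← Finset.prod_smul]
  congr 1
  refine Finset.prod_congr rfl fun o _ => ?_
  rw [smul_pow, monomial_pow, one_pow]

/-- A weight on a linear `k`-uniform family with total at most `k + 2` whose sum at each vertex is
divisible by `k` is `0` or concentrated with value `k` on a single member. -/
theorem eq_zero_or_concentrated {E : Finset (Finset ι)} {k : ℕ} (hk : 3 ≤ k)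
    (hE : ∀ e ∈ E, e.card = k) (hlin : ∀ e ∈ E, ∀ f ∈ E, e ≠ f → (e ∩ f).card ≤ 1)
    (p : Finset ι → ℕ) (hp : ∀ e, p e ≠ 0 → e ∈ E)
    (hdvd : ∀ v, k ∣ ∑ e with v ∈ e, p e) (hsum : ∑ e, p e ≤ k + 2) :
    (∀ e, p e = 0) ∨ ∃ e ∈ E, p e = k ∧ ∀ f, f ≠ e → p f = 0 := by
  -- A positive multiple of k that is at most k + 2 < 2k equals k.
  have h1 : ∀ e, p e ≠ 0 → ∀ v ∈ e, ∑ f with v ∈ f, p f = k := by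
    intro e he v hv
    have hle : ∑ f with v ∈ f, p f ≤ k + 2 :=
      (Finset.sum_le_sum_of_subset (Finset.filter_subset _ _)).trans hsum
    have hpos : p e ≤ ∑ f with v ∈ f, p f :=
      Finset.single_le_sum (f := p) (fun _ _ => Nat.zero_le _) (by simp [hv])
    obtain ⟨c, hc⟩ := hdvd v
    rw [hc] at hle hpos ⊢
    have hc0 : c ≠ 0 := by rintro rfl; omega
    have : c < 2 := by
      by_contra hcon
      have : k * 2 ≤ k * c := Nat.mul_le_mul_left _ (by omega)
      omega
    obtain rfl : c = 1 := by omega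
    simp
  -- Summing the previous equality over v ∈ e and using linearity gives k² = Σ_f |e ∩ f| p f ≤ (k-1)
  -- p e + (k+2). If p e ≤ k - 2, the right side is at most k² - 2k + 4 < k².
  have h2 : ∀ e, p e ≠ 0 → k ≤ p e + 1 := by
    intro e he
    have h3 : ∑ v ∈ e, ∑ f with v ∈ f, p f = k * k := by
      rw [Finset.sum_congr rfl (h1 e he), Finset.sum_const, hE e (hp e he), smul_eq_mul]
    have h4 : ∑ v ∈ e, ∑ f with v ∈ f, p f = ∑ f, (e ∩ f).card * p f := by
      simp only [Finset.sum_filter]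
      rw [Finset.sum_comm]
      refine Finset.sum_congr rfl fun f _ => ?_
      rw [← Finset.sum_filter, Finset.sum_const, smul_eq_mul, Finset.filter_mem_eq_inter]
    have h5 : ∑ f, (e ∩ f).card * p f ≤ ∑ f, (p f + if f = e then (k - 1) * p e else 0) := by
      refine Finset.sum_le_sum fun f _ => ?_
      by_cases hfe : f = e
      · subst hfe
        rw [Finset.inter_self, hE f (hp f he), if_pos rfl]
        obtain ⟨k, rfl⟩ : ∃ k', k = k' + 1 := ⟨k - 1, by omega⟩
        simp only [Nat.add_sub_cancel]
        linarith
      · rw [if_neg hfe, add_zero]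
        by_cases hf : p f = 0
        · simp [hf]
        · simpa using Nat.mul_le_mul_right (p f) (hlin e (hp e he) f (hp f hf) (Ne.symm hfe))
    rw [Finset.sum_add_distrib, Finset.sum_ite_eq' Finset.univ e, if_pos (Finset.mem_univ _),
      ← h4, h3] at h5
    by_contra hcon
    obtain ⟨k, rfl⟩ : ∃ k', k = k' + 3 := ⟨k - 3, by omega⟩
    have h6 : (k + 3 - 1) * p e ≤ (k + 2) * (k + 1) := Nat.mul_le_mul (by omega) (by omega)
    nlinarith
  -- Another used member through v would bring the sum at v to at least 2(k-1) > k.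
  have h3 : ∀ e, p e ≠ 0 → p e = k := by
    intro e he
    obtain ⟨v, hv⟩ : e.Nonempty := by rw [← Finset.card_pos, hE e (hp e he)]; omega
    have h4 := h1 e he v hv
    rw [← Finset.add_sum_erase _ _ (show e ∈ Finset.univ.filter (fun f => v ∈ f) by simp [hv])]
      at h4
    by_contra hne
    have h5 := h2 e he
    obtain ⟨f, hf, hf0⟩ := Finset.exists_ne_zero_of_sum_ne_zero
      (show ∑ x ∈ (Finset.univ.filter (fun f => v ∈ f)).erase e, p x ≠ 0 by omega)
    have h6 := Finset.single_le_sum (f := p) (fun _ _ => Nat.zero_le _) hf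
    have h7 := h2 f hf0
    omega
  by_cases h0 : ∀ e, p e = 0
  · exact Or.inl h0
  · push Not at h0
    obtain ⟨e, he⟩ := h0
    refine Or.inr ⟨e, hp e he, h3 e he, fun f hf => ?_⟩
    by_contra hf0
    -- Two used members would have total weight 2k > k + 2.
    have := Finset.sum_le_sum_of_subset (f := p) (Finset.subset_univ {e, f})
    rw [Finset.sum_pair (Ne.symm hf), h3 e he, h3 f hf0] at this
    omega

end RTensor

/-! ### Choices of terms that contribute to low-order traces -/

namespace RTensor

open MvPolynomial
open Finsupp (single)

variable {ι : Type*} [Fintype ι] [DecidableEq ι]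

omit [Fintype ι] in
theorem termArcs_none_apply (k : ℕ) (i x y : ι) :
    termArcs k i none (x, y) = if i = x ∧ i = y then k - 1 else 0 := by
  simp only [termArcs, Finsupp.single_apply, Prod.mk.injEq]

omit [Fintype ι] in
theorem termArcs_some_apply (k : ℕ) (i x y : ι) (e : Finset ι) :
    termArcs k i (some e) (x, y) = if i = x ∧ y ∈ e ∧ y ≠ i then 1 else 0 := by
  simp only [termArcs, Finsupp.finsetSum_apply, Finsupp.single_apply, Prod.mk.injEq]
  by_cases h : i = x
  · simp [h, and_comm]
  · simp [h]

theorem productArcs_apply (k : ℕ) (Q : ι → Option (Finset ι) → ℕ) (x y : ι) :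
    productArcs k Q (x, y) = (if x = y then Q x none * (k - 1) else 0) +
      ∑ e, if y ∈ e ∧ y ≠ x then Q x (some e) else 0 := by
  simp only [productArcs, Finsupp.finsetSum_apply, Finsupp.add_apply, Finsupp.smul_apply,
    Fintype.sum_option,
    termArcs_none_apply, termArcs_some_apply, smul_eq_mul, mul_ite, mul_zero, mul_one]
  rw [Finset.sum_eq_single x]
  · simp
  · intro i _ hi
    simp [hi]
  · simp

/-- The choice of loops only. -/
def loopChoice (D : ι → ℕ) (i : ι) : Option (Finset ι) → ℕ
  | none => D i
  | some _ => 0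

/-- The choice of one hyperedge term in each row of `e`, and of loops otherwise. -/
def edgeChoice (e : Finset ι) (D : ι → ℕ) (i : ι) : Option (Finset ι) → ℕ
  | none => D i - 1
  | some f => if f = e ∧ i ∈ e then 1 else 0

/-- Only pure loops and a single hyperedge with loops at its vertices contribute to traces of
order at most `k + 2`. -/
theorem eq_loopChoice_or_edgeChoice {E : Finset (Finset ι)} {k N : ℕ} (hk : 3 ≤ k)
    (hE : ∀ e ∈ E, e.card = k) (hlin : ∀ e ∈ E, ∀ f ∈ E, e ≠ f → (e ∩ f).card ≤ 1)
    {D : ι → ℕ} (hD : ∑ i, D i ≤ k + 2) {Q : ι → Option (Finset ι) → ℕ}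
    (hQD : ∀ i, ∑ o, Q i o = D i) (hQE : ∀ i e, Q i (some e) ≠ 0 → e ∈ E ∧ i ∈ e)
    (hcoeff : coeff (productArcs k Q) (auxTrace ι N) ≠ 0) :
    Q = loopChoice D ∨
      Finset.univ.filter (fun i => D i ≠ 0) ∈ E ∧
        Q = edgeChoice (Finset.univ.filter (fun i => D i ≠ 0)) D := by
  set p : Finset ι → ℕ := fun e => ∑ i, Q i (some e) with hp
  have hsplit : ∀ i, Q i none + ∑ e, Q i (some e) = D i := fun i => by
    rw [← hQD i, Fintype.sum_option]
  have hpE : ∀ e, p e ≠ 0 → e ∈ E := by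
    intro e he
    obtain ⟨i, -, hi⟩ := Finset.exists_ne_zero_of_sum_ne_zero he
    exact (hQE i e hi).1
  have hsum : ∑ e, p e ≤ k + 2 := by
    rw [hp, Finset.sum_comm]
    refine (Finset.sum_le_sum fun i _ => ?_).trans hD
    have := hsplit i
    omega
  have hout : ∀ v, ∑ y, productArcs k Q (v, y) =
      Q v none * (k - 1) + ∑ e, (k - 1) * Q v (some e) := by
    intro v
    simp only [productArcs_apply, Finset.sum_add_distrib, Finset.sum_ite_eq, Finset.mem_univ,
      if_true]
    congr 1
    rw [Finset.sum_comm]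
    refine Finset.sum_congr rfl fun e _ => ?_
    by_cases h0 : Q v (some e) = 0
    · simp [h0]
    · obtain ⟨he, hv⟩ := hQE v e h0
      rw [← Finset.sum_filter, Finset.sum_const, smul_eq_mul]
      congr 1
      rw [← hE e he, ← Finset.card_erase_of_mem hv]
      congr 1
      ext y
      simp [and_comm]
  have hin : ∀ v, ∑ x, productArcs k Q (x, v) + ∑ e, Q v (some e) =
      Q v none * (k - 1) + ∑ e with v ∈ e, p e := by
    intro v
    simp only [productArcs_apply, Finset.sum_add_distrib, Finset.sum_ite_eq', Finset.mem_univ,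
      if_true]
    rw [add_assoc]
    congr 1
    rw [Finset.sum_comm, ← Finset.sum_add_distrib, Finset.sum_filter]
    refine Finset.sum_congr rfl fun e _ => ?_
    by_cases hv : v ∈ e
    · simp only [hv, true_and, if_true, hp]
      rw [← Finset.add_sum_erase _ _ (Finset.mem_univ v),
        ← Finset.add_sum_erase _ (fun i => Q i (some e)) (Finset.mem_univ v)]
      simp only [ne_eq, not_true_eq_false, if_false, zero_add]
      rw [add_comm]
      congr 1
      refine Finset.sum_congr rfl fun i hi => ?_
      rw [if_pos (Finset.ne_of_mem_erase hi).symm]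
    · have : Q v (some e) = 0 := by
        by_contra h
        exact hv (hQE v e h).2
      simp [hv, this]
  -- A hyperedge term of row v has k - 1 arcs leaving v, while the hyperedge arcs entering v come
  -- from the other rows. Adding the uses in row v itself to both sides of the balance equation
  -- turns k - 1 into k.
  have hbal : ∀ v, k * ∑ e, Q v (some e) = ∑ e with v ∈ e, p e := by
    intro v
    have h1 := balanced_of_coeff_auxTrace_ne_zero hcoeff v
    rw [hout] at h1
    have h2 := hin v
    rw [← h1, ← Finset.mul_sum] at h2
    obtain ⟨k, rfl⟩ : ∃ k', k = k' + 1 := ⟨k - 1, by omega⟩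
    simp only [Nat.add_sub_cancel] at h2
    linarith
  rcases eq_zero_or_concentrated hk hE hlin p hpE
    (fun v => ⟨_, (hbal v).symm⟩) hsum with h0 | ⟨e, heE, hpe, hpf⟩
  · left
    have hz : ∀ i e, Q i (some e) = 0 := fun i e =>
      (Finset.sum_eq_zero_iff.1 (h0 e)) i (Finset.mem_univ i)
    funext i o
    cases o with
    | none => simpa [hz, loopChoice] using hsplit i
    | some e => exact hz i e
  · right
    have hz : ∀ i f, f ≠ e → Q i (some f) = 0 := fun i f hf =>
      (Finset.sum_eq_zero_iff.1 (hpf f hf)) i (Finset.mem_univ i)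
    have hz' : ∀ i, i ∉ e → Q i (some e) = 0 := fun i hi => by
      by_contra h
      exact hi (hQE i e h).2
    -- The balance at i now reads k · Q i (some e) = k.
    have hone : ∀ i ∈ e, Q i (some e) = 1 := by
      intro i hi
      have h1 := hbal i
      rw [Finset.sum_eq_single e (fun f _ hf => hz i f hf) (by simp),
        Finset.sum_eq_single e (fun f _ hf => hpf f hf) (by simp [hi]), hpe] at h1
      exact Nat.eq_of_mul_eq_mul_left (by omega) (h1.trans (mul_one k).symm)
    have hsame : ∀ i, Q i none + Q i (some e) = D i := fun i => by
      rw [← hsplit i, Finset.sum_eq_single e (fun f _ hf => hz i f hf) (by simp)]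
    have hcross : ∀ x y, productArcs k Q (x, y) ≠ 0 → (x ∈ (e : Set ι) ↔ y ∈ (e : Set ι)) := by
      intro x y hxy
      simp only [Finset.mem_coe]
      rw [productArcs_apply, Finset.sum_eq_single e (fun f _ hf => by simp [hz x f hf])
        (by simp)] at hxy
      by_cases hxy' : x = y
      · rw [hxy']
      · rw [if_neg hxy', zero_add] at hxy
        have h1 := (ite_ne_right_iff.1 hxy)
        exact ⟨fun _ => h1.1.1, fun _ => (hQE x e h1.2).2⟩
    -- The arcs of the hyperedge lie inside e and no arc crosses its boundary, so a closed walk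
    -- cannot also use a loop outside e.
    have hloop : ∀ i, i ∉ e → Q i none = 0 := by
      intro i hi
      by_contra hne
      rcases subset_or_subset_compl_of_coeff_auxTrace_ne_zero (e : Set ι) hcross hcoeff with h | h
      · refine hi (h i i ?_)
        rw [productArcs_apply, if_pos rfl]
        have : 0 < Q i none * (k - 1) := Nat.mul_pos (Nat.pos_of_ne_zero hne) (by omega)
        omega
      · obtain ⟨x, hx, y, hy, hxy⟩ := Finset.one_lt_card.1 (show 1 < e.card by
          rw [hE e heE]; omega)
        refine h x y ?_ hx
        rw [productArcs_apply, Finset.sum_eq_single e (fun f _ hf => by simp [hz x f hf])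
          (by simp), if_neg hxy, zero_add, if_pos ⟨hy, hxy.symm⟩, hone x hx]
        exact one_ne_zero
    have hsupp : Finset.univ.filter (fun i => D i ≠ 0) = e := by
      ext i
      simp only [Finset.mem_filter, Finset.mem_univ, true_and]
      have := hsame i
      by_cases hi : i ∈ e
      · have := hone i hi
        simp only [hi, iff_true]
        omega
      · have h1 := hz' i hi
        have h2 := hloop i hi
        simp only [hi, iff_false]
        omega
    rw [hsupp]
    refine ⟨heE, ?_⟩
    funext i o
    have h3 := hsame i
    cases o with
    | none =>
      by_cases hi : i ∈ e
      · have := hone i hi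
        simp only [edgeChoice]
        omega
      · have h1 := hz' i hi
        have h2 := hloop i hi
        simp only [edgeChoice]
        omega
    | some f =>
      by_cases hf : f = e
      · subst hf
        by_cases hi : i ∈ f
        · simp [edgeChoice, hi, hone i hi]
        · simp [edgeChoice, hi, hz' i hi]
      · simp [edgeChoice, hf, hz i f hf]

end RTensor

/-! ### Splitting low-order traces into loop and hyperedge contributions -/

namespace RTensor

open MvPolynomial
open Finsupp (single)

variable {ι : Type*} [Fintype ι] [DecidableEq ι]

theorem productArcs_loopChoice (k : ℕ) (D : ι → ℕ) :
    productArcs k (loopChoice D) = ∑ i, single (i, i) (D i * (k - 1)) := by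
  simp only [productArcs, Fintype.sum_option, loopChoice, termArcs, Finsupp.smul_single,
    smul_eq_mul, zero_smul, Finset.sum_const_zero, add_zero]

theorem productCoeff_loopChoice (E : Finset (Finset ι)) (α : ℝ) (D : ι → ℕ) :
    productCoeff E α (loopChoice D) = ∏ i, (α * familyDegree E i) ^ D i := by
  refine Finset.prod_congr rfl fun i _ => ?_
  simp [Nat.multinomial, Fintype.sum_option, Fintype.prod_option, loopChoice, termCoeff,
    Nat.div_self (Nat.factorial_pos _)]

theorem productArcs_edgeChoice (k : ℕ) (D : ι → ℕ) {e : Finset ι} (he : ∀ i, D i ≠ 0 ↔ i ∈ e) :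
    productArcs k (edgeChoice e D) = completeArcs e fun i => (D i - 1) * (k - 1) := by
  rw [productArcs, completeArcs, ← Finset.sum_subset (Finset.subset_univ e)]
  · refine Finset.sum_congr rfl fun i hi => ?_
    rw [Fintype.sum_option, Finset.sum_eq_single e (fun f _ hf => by simp [edgeChoice, hf])
      (by simp)]
    simp only [edgeChoice, termArcs, hi, and_self, if_true, one_smul, Finsupp.smul_single,
      smul_eq_mul]
  · intro i _ hi
    have : D i = 0 := by
      by_contra h
      exact hi ((he i).1 h)
    simp [Fintype.sum_option, edgeChoice, this, hi]

theorem productCoeff_edgeChoice {E : Finset (Finset ι)} (α : ℝ) (D : ι → ℕ) {e : Finset ι}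
    (heE : e ∈ E) (he : ∀ i, D i ≠ 0 ↔ i ∈ e) :
    productCoeff E α (edgeChoice e D) =
      ∏ i ∈ e, ((D i : ℝ) * ((1 - α) * (α * familyDegree E i) ^ (D i - 1))) := by
  rw [productCoeff, ← Finset.prod_subset (Finset.subset_univ e)]
  · refine Finset.prod_congr rfl fun i hi => ?_
    have hD : D i ≠ 0 := (he i).2 hi
    congr 1
    -- The factor `D i` counts the positions of the single hyperedge term among the `D i` factors of
    -- the row.
    · rw [Nat.multinomial, Fintype.sum_option, Fintype.prod_option]
      simp only [edgeChoice, hi, and_true, Finset.sum_ite_eq', Finset.mem_univ, if_true,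
        apply_ite Nat.factorial, Nat.factorial_one, Nat.factorial_zero, ite_self,
        Finset.prod_const_one, mul_one]
      rw [Nat.sub_add_cancel (Nat.pos_of_ne_zero hD), ← Nat.mul_factorial_pred hD,
        Nat.mul_div_cancel _ (Nat.factorial_pos _)]
    · rw [Fintype.prod_option, Finset.prod_eq_single e (fun f _ hf => by simp [edgeChoice, hf])
        (by simp), mul_comm]
      simp [edgeChoice, termCoeff, heE, hi]
  · intro i _ hi
    have h0 : D i = 0 := by
      by_contra h
      exact hi ((he i).1 h)
    simp [Nat.multinomial, Fintype.sum_option, edgeChoice, h0, hi]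

omit [DecidableEq ι] in
theorem sum_loopChoice (D : ι → ℕ) (i : ι) : ∑ o, loopChoice D i o = D i := by
  simp [Fintype.sum_option, loopChoice]

theorem sum_edgeChoice (D : ι → ℕ) {e : Finset ι} (he : ∀ i, D i ≠ 0 ↔ i ∈ e) (i : ι) :
    ∑ o, edgeChoice e D i o = D i := by
  rw [Fintype.sum_option]
  by_cases hi : i ∈ e
  · have := (he i).2 hi
    simp only [edgeChoice, hi, and_true, Finset.sum_ite_eq', Finset.mem_univ, if_true]
    omega
  · have : D i = 0 := by
      by_contra h
      exact hi ((he i).1 h)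
    simp [edgeChoice, hi, this]

/-- The support of an exponent vector, as a finset. -/
def supp (D : ι → ℕ) : Finset ι := Finset.univ.filter fun i => D i ≠ 0

omit [DecidableEq ι] in
theorem mem_supp {D : ι → ℕ} {i : ι} : i ∈ supp D ↔ D i ≠ 0 := by simp [supp]

theorem pairing_auxTrace_ne_zero {N : ℕ} {M : ι × ι →₀ ℕ} :
    pairing (auxTrace ι N) (monomial M 1) ≠ 0 ↔ coeff M (auxTrace ι N) ≠ 0 := by
  rw [pairing_monomial, mul_ne_zero_iff, and_iff_right]
  exact Finset.prod_ne_zero_iff.2 fun x _ => by exact_mod_cast Nat.factorial_ne_zero _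

theorem pairing_auxTrace_pos {N : ℕ} {M : ι × ι →₀ ℕ} (h : 0 < coeff M (auxTrace ι N)) :
    0 < pairing (auxTrace ι N) (monomial M 1) := by
  rw [pairing_monomial]
  exact mul_pos (Finset.prod_pos fun x _ => by exact_mod_cast Nat.factorial_pos _) h

/-- For a given D at most two choices of terms survive: loops throughout and, when the support of D
is a hyperedge, that hyperedge once in each of its rows. -/
theorem pairing_prod_rowPoly_pow {E : Finset (Finset ι)} {k : ℕ} (hk : 3 ≤ k)
    (hE : ∀ e ∈ E, e.card = k) (hlin : ∀ e ∈ E, ∀ f ∈ E, e ≠ f → (e ∩ f).card ≤ 1) (α : ℝ)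
    (N : ℕ) {D : ι → ℕ} (hD : ∑ i, D i ≤ k + 2) :
    pairing (auxTrace ι N) (∏ i, rowPoly (familyTensor E k α) i ^ D i) =
      (∏ i, (α * familyDegree E i) ^ D i) *
          pairing (auxTrace ι N) (monomial (∑ i, single (i, i) (D i * (k - 1))) 1) +
        if supp D ∈ E then
          (∏ i ∈ supp D, ((D i : ℝ) * ((1 - α) * (α * familyDegree E i) ^ (D i - 1)))) *
            pairing (auxTrace ι N)
              (monomial (completeArcs (supp D) fun i => (D i - 1) * (k - 1)) 1)
        else 0 := by
  have he : ∀ i, D i ≠ 0 ↔ i ∈ supp D := fun i => mem_supp.symm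
  rw [prod_rowPoly_pow (by omega) hE, map_sum]
  simp only [map_smul, smul_eq_mul]
  have hmem : ∀ Q : ι → Option (Finset ι) → ℕ,
      Q ∈ (Fintype.piFinset fun i => Finset.piAntidiag Finset.univ (D i)) ↔
        ∀ i, ∑ o, Q i o = D i := by
    intro Q
    simp [Fintype.mem_piFinset]
  have hzero : ∀ Q ∈ (Fintype.piFinset fun i => Finset.piAntidiag Finset.univ (D i)),
      Q ≠ loopChoice D → ¬ (supp D ∈ E ∧ Q = edgeChoice (supp D) D) →
      productCoeff E α Q * pairing (auxTrace ι N) (monomial (productArcs k Q) 1) = 0 := by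
    intro Q hQ h1 h2
    by_contra hne
    obtain ⟨hc, ha⟩ := mul_ne_zero_iff.1 hne
    have hQE : ∀ i e, Q i (some e) ≠ 0 → e ∈ E ∧ i ∈ e := by
      intro i e hie
      have h3 := Finset.prod_ne_zero_iff.1 hc i (Finset.mem_univ i)
      have h4 := Finset.prod_ne_zero_iff.1 (mul_ne_zero_iff.1 h3).2 (some e) (Finset.mem_univ _)
      by_contra h5
      exact h4 (by simp [termCoeff, h5, hie])
    exact (eq_loopChoice_or_edgeChoice hk hE hlin hD ((hmem Q).1 hQ) hQE
      (pairing_auxTrace_ne_zero.1 ha)).elim h1 h2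
  by_cases hs : supp D ∈ E
  · have hne : loopChoice D ≠ edgeChoice (supp D) D := by
      intro h
      obtain ⟨i, hi⟩ : (supp D).Nonempty := by rw [← Finset.card_pos, hE _ hs]; omega
      have := congrFun (congrFun h i) (some (supp D))
      simp [loopChoice, edgeChoice, hi] at this
    rw [Finset.sum_eq_add_of_mem _ _ ((hmem _).2 (sum_loopChoice D))
      ((hmem _).2 (sum_edgeChoice D he)) hne fun Q hQ h => hzero Q hQ h.1 fun h' => h.2 h'.2,
      if_pos hs, productArcs_loopChoice, productCoeff_loopChoice, productArcs_edgeChoice k D he,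
      productCoeff_edgeChoice α D hs he]
  · rw [Finset.sum_eq_single_of_mem _ ((hmem _).2 (sum_loopChoice D))
      fun Q hQ h => hzero Q hQ h fun h' => hs h'.1, if_neg hs, add_zero, productArcs_loopChoice,
      productCoeff_loopChoice]

/-- The contribution to the trace of order `d` of the loops at `i`, up to the factor
`(α deg i)^d`. -/
noncomputable def loopWeight (k d : ℕ) (i : ι) : ℝ :=
  1 / ((d * (k - 1))! : ℝ) *
    pairing (auxTrace ι (d * (k - 1))) (monomial (single (i, i) (d * (k - 1))) 1)

/-- The contribution to the trace of one hyperedge with loops at its vertices, row `i` being used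
`D i` times, up to a product of powers of degrees. -/
noncomputable def edgeWeight (k : ℕ) (α : ℝ) (D : ι → ℕ) : ℝ :=
  (∏ i, (1 / ((D i * (k - 1))! : ℝ))) *
    ((∏ i ∈ supp D, ((D i : ℝ) * ((1 - α) * α ^ (D i - 1)))) *
      pairing (auxTrace ι ((∑ i, D i) * (k - 1)))
        (monomial (completeArcs (supp D) fun i => (D i - 1) * (k - 1)) 1))

/-- Loops at different vertices do not join up to one closed walk. -/
theorem pairing_loops_ne_zero {k N : ℕ} (hk : 3 ≤ k) {D : ι → ℕ}
    (h : pairing (auxTrace ι N) (monomial (∑ i, single (i, i) (D i * (k - 1))) 1) ≠ 0)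
    {i j : ι} (hi : D i ≠ 0) (hj : D j ≠ 0) : i = j := by
  have happ : ∀ x y, (∑ i, single (i, i) (D i * (k - 1)) : ι × ι →₀ ℕ) (x, y)
      = if x = y then D x * (k - 1) else 0 := by
    intro x y
    rw [← productArcs_loopChoice, productArcs_apply]
    simp [loopChoice]
  have hne : ∀ x, D x ≠ 0 →
      (∑ i, single (i, i) (D i * (k - 1)) : ι × ι →₀ ℕ) (x, x) ≠ 0 := by
    intro x hx
    rw [happ, if_pos rfl]
    exact Nat.mul_ne_zero hx (by omega)
  have hcross : ∀ x y, (∑ i, single (i, i) (D i * (k - 1)) : ι × ι →₀ ℕ) (x, y) ≠ 0 →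
      (x ∈ ({j} : Set ι) ↔ y ∈ ({j} : Set ι)) := by
    intro x y hxy
    rw [happ] at hxy
    rw [(ite_ne_right_iff.1 hxy).1]
  rcases subset_or_subset_compl_of_coeff_auxTrace_ne_zero {j} hcross
    (pairing_auxTrace_ne_zero.1 h) with h | h
  · exact h i i (hne i hi)
  · exact absurd rfl (h j j (hne j hj))

/-- In the loop part only vectors D concentrated at one vertex remain; the hyperedge part is
regrouped by the support of D. -/
theorem trace_familyTensor {E : Finset (Finset ι)} {k : ℕ} (hk : 3 ≤ k)
    (hE : ∀ e ∈ E, e.card = k) (hlin : ∀ e ∈ E, ∀ f ∈ E, e ≠ f → (e ∩ f).card ≤ 1) (α : ℝ)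
    {d : ℕ} (hd : d ≠ 0) (hdk : d ≤ k + 2) :
    (familyTensor E k α).trace d = ((k : ℝ) - 1) ^ (Fintype.card ι - 1) *
      (∑ i, loopWeight k d i * (α * familyDegree E i) ^ d +
        ∑ e ∈ E, ∑ D ∈ Finset.piAntidiag Finset.univ d with supp D = e,
          edgeWeight k α D * ∏ i ∈ e, (familyDegree E i : ℝ) ^ (D i - 1)) := by
  rw [trace_eq_sum_pairing]
  congr 1
  have hsum : ∀ D ∈ Finset.piAntidiag (Finset.univ : Finset ι) d, ∑ i, D i = d := fun D hD =>
    (Finset.mem_piAntidiag.1 hD).1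
  rw [Finset.sum_congr rfl fun D hD => by
    rw [pairing_prod_rowPoly_pow hk hE hlin α _ ((hsum D hD).trans_le hdk)]]
  simp only [mul_add, Finset.sum_add_distrib]
  congr 1
  · symm
    refine Finset.sum_of_injOn (fun i => Pi.single i d) ?_ ?_ ?_ ?_
    · intro i _ j _ hij
      by_contra hne
      have := congrFun hij i
      simp [hne, hd] at this
    · intro i _
      simp
    · intro D hD hDi
      by_contra hne
      have hp := (mul_ne_zero_iff.1 (mul_ne_zero_iff.1 hne).2).2
      obtain ⟨i, -, hi⟩ := Finset.exists_ne_zero_of_sum_ne_zero ((hsum D hD).trans_ne hd)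
      have hD0 : ∀ j, j ≠ i → D j = 0 := fun j hj => by
        by_contra hj0
        exact hj (pairing_loops_ne_zero hk hp hj0 hi)
      refine hDi ⟨i, by simp, ?_⟩
      have hDi : D i = d := by
        rw [← hsum D hD, Finset.sum_eq_single i (fun j _ hj => hD0 j hj) (by simp)]
      funext j
      by_cases hj : j = i
      · subst hj; simp [hDi]
      · simp [hj, hD0 j hj]
    · intro i _
      rw [Finset.prod_eq_single i (fun j _ hj => by simp [hj]) (by simp),
        Finset.prod_eq_single i (fun j _ hj => by simp [hj]) (by simp),
        Finset.sum_eq_single i (fun j _ hj => by simp [hj]) (by simp)]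
      simp only [Pi.single_eq_same, loopWeight]
      ring
  · simp only [Finset.sum_filter]
    rw [Finset.sum_comm]
    refine Finset.sum_congr rfl fun D hD => ?_
    rw [Finset.sum_ite_eq]
    by_cases hs : supp D ∈ E
    · rw [if_pos hs, if_pos hs, edgeWeight, hsum D hD]
      simp only [mul_pow, Finset.prod_mul_distrib]
      ring
    · rw [if_neg hs, if_neg hs, mul_zero]

end RTensor

/-! ### Symmetry and positivity of the weights -/

namespace RTensor

open MvPolynomial
open Finsupp (single)

variable {ι : Type*} [Fintype ι] [DecidableEq ι]

omit [Fintype ι] in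
theorem mapDomain_completeArcs (σ : Equiv.Perm ι) (s : Finset ι) (l : ι → ℕ) :
    Finsupp.mapDomain (σ.prodCongr σ) (completeArcs s (l ∘ σ)) =
      completeArcs (s.map σ.toEmbedding) l := by
  simp only [completeArcs, Finsupp.mapDomain_finsetSum, Finsupp.mapDomain_add,
    Finsupp.mapDomain_single, Finset.sum_map, Equiv.prodCongr_apply, Prod.map, Function.comp_apply,
    Equiv.coe_toEmbedding]
  refine Finset.sum_congr rfl fun i _ => ?_
  congr 1
  rw [← Equiv.coe_toEmbedding σ, ← Finset.map_erase, Finset.sum_map]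

theorem pairing_auxTrace_mapDomain (σ : Equiv.Perm ι) (N : ℕ) (M : ι × ι →₀ ℕ) :
    pairing (auxTrace ι N) (monomial (Finsupp.mapDomain (σ.prodCongr σ) M) 1) =
      pairing (auxTrace ι N) (monomial M 1) := by
  rw [← pairing_rename (σ.prodCongr σ) (monomial M 1), rename_auxTrace, rename_monomial]

/-- Since tr(A^N) is invariant under simultaneous relabelling of rows and columns, the weight
depends only on the values taken by D and not on where they are taken. -/
theorem edgeWeight_comp (k : ℕ) (α : ℝ) (σ : Equiv.Perm ι) (D : ι → ℕ) :
    edgeWeight k α (D ∘ σ) = edgeWeight k α D := by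
  have hsupp : (supp (D ∘ σ)).map σ.toEmbedding = supp D := by
    ext i
    simp [mem_supp]
  rw [edgeWeight, edgeWeight, ← pairing_auxTrace_mapDomain σ]
  have h := mapDomain_completeArcs σ (supp (D ∘ σ)) fun i => (D i - 1) * (k - 1)
  rw [hsupp] at h
  simp only [Function.comp_def] at h
  simp only [Function.comp_def, h]
  congr 1
  · exact Equiv.prod_comp σ fun i => (1 / ((D i * (k - 1))! : ℝ))
  · congr 1
    · rw [← hsupp, Finset.prod_map]
      rfl
    · rw [Equiv.sum_comp σ D]

theorem loopWeight_eq (k d : ℕ) (i j : ι) : loopWeight k d i = loopWeight k d j := by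
  rw [loopWeight, loopWeight, ← pairing_auxTrace_mapDomain (Equiv.swap i j),
    Finsupp.mapDomain_single]
  simp

theorem loopWeight_pos (k d : ℕ) (i : ι) : 0 < loopWeight k d i := by
  refine mul_pos (by positivity) (pairing_auxTrace_pos ((IsArcWalk.loops i _).coeff_auxTrace_pos ?_))
  simp [Finsupp.single_apply]

theorem sum_completeArcs {s : Finset ι} (l : ι → ℕ) :
    ∑ x, completeArcs s l x = ∑ i ∈ s, (l i + (s.card - 1)) := by
  have h : ∀ (x : ι × ι) (n : ℕ), ∑ y, single x n y = n := fun x n => by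
    simp [Finsupp.single_apply]
  simp only [completeArcs, Finsupp.finsetSum_apply, Finsupp.add_apply]
  rw [Finset.sum_comm]
  refine Finset.sum_congr rfl fun i hi => ?_
  rw [Finset.sum_add_distrib, Finset.sum_comm]
  simp [h, Finset.card_erase_of_mem hi]

theorem edgeWeight_pos {k : ℕ} (hk : 1 ≤ k) {α : ℝ} (hα₀ : 0 < α) (hα₁ : α < 1) {D : ι → ℕ}
    (hD : (supp D).card = k) : 0 < edgeWeight k α D := by
  obtain ⟨b, hb⟩ : (supp D).Nonempty := by rw [← Finset.card_pos]; omega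
  have h1 : 0 < 1 - α := by linarith
  refine mul_pos (Finset.prod_pos fun i _ => by positivity) (mul_pos (Finset.prod_pos fun i hi => ?_)
    (pairing_auxTrace_pos ((isArcWalk_completeArcs hb _).coeff_auxTrace_pos ?_)))
  · have : 0 < D i := Nat.pos_of_ne_zero (mem_supp.1 hi)
    positivity
  -- Each vertex i of the support contributes (D i - 1)(k - 1) loops and k - 1 arcs to the other
  -- vertices, that is, D i (k - 1) arcs, which add up to the required length.
  · rw [sum_completeArcs, hD, ← Finset.sum_subset (Finset.subset_univ (supp D)), Finset.sum_mul]
    · refine Finset.sum_congr rfl fun i hi => ?_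
      obtain ⟨c, hc⟩ := Nat.exists_eq_succ_of_ne_zero (mem_supp.1 hi)
      rw [hc]
      simp [Nat.succ_mul]
    · intro i _ hi
      by_contra h
      exact hi (mem_supp.2 h)

/-- A permutation carrying two points of a finset to two points of another one of the same size. -/
theorem exists_perm_map_eq {s t : Finset ι} (h : s.card = t.card) {a b c d : ι} (ha : a ∈ s)
    (hb : b ∈ s) (hab : a ≠ b) (hc : c ∈ t) (hd : d ∈ t) (hcd : c ≠ d) :
    ∃ σ : Equiv.Perm ι, (∀ x, σ x ∈ t ↔ x ∈ s) ∧ σ a = c ∧ σ b = d := by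
  have hswap : ∀ (σ : Equiv.Perm ι), (∀ x, σ x ∈ t ↔ x ∈ s) → ∀ x ∈ s, ∀ y ∈ t,
      ∀ z, (Equiv.swap (σ x) y * σ) z ∈ t ↔ z ∈ s := by
    intro σ hσ x hx y hy z
    rw [Equiv.Perm.mul_apply, ← hσ z, Equiv.swap_apply_def]
    have := (hσ x).2 hx
    split_ifs with h1 h2
    · simp [h1, hy, this]
    · simp [h2, hy, this]
    · rfl
  let σ₀ : Equiv.Perm ι := (Fintype.equivOfCardEq (α := {x // x ∈ s}) (β := {x // x ∈ t})
    (by simpa using h)).extendSubtype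
  have h0 : ∀ x, σ₀ x ∈ t ↔ x ∈ s := fun x =>
    ⟨fun hx => by
      by_contra hxs
      exact Equiv.extendSubtype_not_mem _ x hxs hx, fun hx => Equiv.extendSubtype_mem _ x hx⟩
  have h1 := hswap σ₀ h0 a ha c hc
  set σ₁ := Equiv.swap (σ₀ a) c * σ₀
  have h1a : σ₁ a = c := by simp [σ₁]
  refine ⟨Equiv.swap (σ₁ b) d * σ₁, hswap σ₁ h1 b hb d hd, ?_, by simp⟩
  rw [Equiv.Perm.mul_apply, h1a, Equiv.swap_apply_of_ne_of_ne _ hcd]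
  rw [← h1a]
  exact fun h => hab (σ₁.injective h)

/-- The indicator function of a finset. -/
def ind (e : Finset ι) (i : ι) : ℕ := if i ∈ e then 1 else 0

/-- A vector with support e and total k + r is one unit at each vertex of e plus a free distribution
of r further units on e; the latter are the loops. -/
theorem sum_filter_supp_eq {e : Finset ι} {k r : ℕ} (he : e.card = k) (F : (ι → ℕ) → ℝ) :
    ∑ D ∈ Finset.piAntidiag Finset.univ (k + r) with supp D = e, F D =
      ∑ l ∈ e.piAntidiag r, F (ind e + l) := by
  have hind : ∑ i, ind e i = k := by simp [ind, he]
  symm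
  refine Finset.sum_nbij' (fun l => ind e + l) (fun D => D - ind e) ?_ ?_ ?_ ?_ ?_
  · intro l hl
    rw [Finset.mem_piAntidiag] at hl
    have hsum : ∑ i, l i = r := by
      rw [← hl.1]
      exact (Finset.sum_subset (Finset.subset_univ e) fun i _ hi => by
        by_contra h
        exact hi (hl.2 i h)).symm
    simp only [Finset.mem_filter, Finset.mem_piAntidiag, Pi.add_apply, Finset.sum_add_distrib, hind,
      hsum, Finset.mem_univ, implies_true, and_self, true_and]
    ext i
    by_cases hi : i ∈ e
    · simp [mem_supp, ind, hi]
    · have : l i = 0 := by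
        by_contra h
        exact hi (hl.2 i h)
      simp [mem_supp, ind, hi, this]
  · intro D hD
    simp only [Finset.mem_filter, Finset.mem_piAntidiag] at hD
    obtain ⟨⟨h1, -⟩, h2⟩ := hD
    have h3 : ∀ i, D i ≠ 0 ↔ i ∈ e := fun i => by rw [← h2, mem_supp]
    have h4 : ∀ i, (D - ind e) i + ind e i = D i := fun i => by
      rw [Pi.sub_apply]
      refine Nat.sub_add_cancel ?_
      by_cases hi : i ∈ e
      · have := (h3 i).2 hi
        simp only [ind, hi, if_true]; omega
      · simp [ind, hi]
    rw [Finset.mem_piAntidiag]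
    have h5 : ∀ i, (D - ind e) i ≠ 0 → i ∈ e := fun i hi => (h3 i).1 (by
      have := h4 i
      omega)
    refine ⟨?_, h5⟩
    change ∑ i ∈ e, (D - ind e) i = r
    rw [Finset.sum_subset (Finset.subset_univ e) fun i _ hi => by
        by_contra h
        exact hi (h5 i h)]
    have := Finset.sum_congr rfl fun i (_ : i ∈ Finset.univ) => h4 i
    rw [Finset.sum_add_distrib, h1, hind] at this
    omega
  · intro l _; ext i; simp
  · intro D hD
    simp only [Finset.mem_filter] at hD
    ext i
    simp only [Pi.add_apply, Pi.sub_apply]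
    refine Nat.add_sub_cancel' ?_
    by_cases hi : i ∈ e
    · rw [← hD.2, mem_supp] at hi
      simp only [ind]
      split_ifs <;> omega
    · simp [ind, hi]
  · intro l _; rfl

-- Double counting of vectors with one of their r + 1 units marked. Applied once or twice, it
-- reduces sums over distributions of one or two loops to sums over vertices or pairs of vertices.
omit [Fintype ι] in
theorem succ_mul_sum_piAntidiag_succ (e : Finset ι) (r : ℕ) (F : (ι → ℕ) → ℝ) :
    ((r + 1 : ℕ) : ℝ) * ∑ l ∈ e.piAntidiag (r + 1), F l =
      ∑ u ∈ e, ∑ l ∈ e.piAntidiag r, ((l u : ℝ) + 1) * F (l + Pi.single u 1) := by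
  have h1 : ((r + 1 : ℕ) : ℝ) * ∑ l ∈ e.piAntidiag (r + 1), F l =
      ∑ u ∈ e, ∑ l ∈ e.piAntidiag (r + 1), (l u : ℝ) * F l := by
    rw [Finset.sum_comm, Finset.mul_sum]
    refine Finset.sum_congr rfl fun l hl => ?_
    rw [← Finset.sum_mul, ← Nat.cast_sum]
    have h : ∑ i ∈ e, l i = r + 1 := (Finset.mem_piAntidiag.1 hl).1
    rw [h]
  rw [h1]
  refine Finset.sum_congr rfl fun u hu => ?_
  symm
  refine Finset.sum_of_injOn (fun l => l + Pi.single u 1) (fun l _ l' _ h => add_right_cancel h)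
    ?_ ?_ ?_
  · intro l hl
    rw [Finset.mem_coe, Finset.mem_piAntidiag] at hl ⊢
    constructor
    · have : ∑ i ∈ e, l i = r := hl.1
      change ∑ i ∈ e, (l + Pi.single u 1 : ι → ℕ) i = r + 1
      simp only [Pi.add_apply, Finset.sum_add_distrib, this]
      rw [Finset.sum_eq_single u (fun i _ hi => by simp [hi]) (fun h => absurd hu h)]
      simp
    · intro i hi
      by_cases h : i = u
      · exact h ▸ hu
      · exact hl.2 i (by simpa [h] using hi)
  · intro l hl hne
    have : l u = 0 := by
      by_contra h0
      refine hne ⟨l - Pi.single u 1, ?_, ?_⟩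
      · rw [Finset.mem_coe, Finset.mem_piAntidiag] at *
        constructor
        · have h2 : ∑ i ∈ e, l i = r + 1 := hl.1
          change ∑ i ∈ e, (l - Pi.single u 1 : ι → ℕ) i = r
          rw [← Finset.add_sum_erase _ _ hu] at h2 ⊢
          have h3 : ∑ i ∈ e.erase u, (l - Pi.single u 1 : ι → ℕ) i = ∑ i ∈ e.erase u, l i :=
            Finset.sum_congr rfl fun i hi => by simp [Finset.ne_of_mem_erase hi]
          rw [h3]
          simp only [Pi.sub_apply, Pi.single_eq_same]
          omega
        · intro i hi
          refine hl.2 i fun h => hi (by simp [h])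
      · funext i
        by_cases h : i = u
        · subst h; simp; omega
        · simp [h]
    simp [this]
  · intro l _
    simp

end RTensor

/-! ### Closed formulas for the traces up to order k + 2 -/

namespace RTensor

variable {ι : Type*} [Fintype ι] [DecidableEq ι]

/-- The comparison of traces needs only that a weight is constant, and in one case positive, not its
value. The constant 1 serves when no object satisfies P, for example when there are fewer than k
vertices. -/
theorem exists_pos_const {κ : Type*} {P : κ → Prop} {f : κ → ℝ} (hpos : ∀ x, P x → 0 < f x)
    (hconst : ∀ x y, P x → P y → f x = f y) : ∃ c, 0 < c ∧ ∀ x, P x → f x = c := by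
  by_cases h : ∃ x, P x
  · obtain ⟨x, hx⟩ := h
    exact ⟨f x, hpos x hx, fun y hy => hconst y x hy hx⟩
  · exact ⟨1, one_pos, fun x hx => absurd ⟨x, hx⟩ h⟩

theorem supp_ind_add {e : Finset ι} {l : ι → ℕ} (hl : ∀ i, l i ≠ 0 → i ∈ e) :
    supp (ind e + l) = e := by
  ext i
  by_cases hi : i ∈ e
  · simp [mem_supp, ind, hi]
  · have : l i = 0 := by
      by_contra h
      exact hi (hl i h)
    simp [mem_supp, ind, hi, this]

theorem edgeWeight_ind_eq {e f : Finset ι} (h : e.card = f.card) {a b c d : ι} (ha : a ∈ e)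
    (hb : b ∈ e) (hab : a ≠ b) (hc : c ∈ f) (hd : d ∈ f) (hcd : c ≠ d) (k p q : ℕ) (α : ℝ) :
    edgeWeight k α (ind e + (Pi.single a p + Pi.single b q)) =
      edgeWeight k α (ind f + (Pi.single c p + Pi.single d q)) := by
  obtain ⟨σ, hσ, rfl, rfl⟩ := exists_perm_map_eq h ha hb hab hc hd hcd
  rw [← edgeWeight_comp k α σ (ind f + _)]
  congr 1
  funext x
  simp [ind, hσ, Pi.single_apply]

/-- The traces of order `p + q + k` of one hyperedge. -/
theorem exists_edgeWeight_eq (ι : Type*) [Fintype ι] [DecidableEq ι] {k : ℕ} (hk : 2 ≤ k) {α : ℝ}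
    (hα₀ : 0 < α) (hα₁ : α < 1) (p q : ℕ) :
    ∃ c, 0 < c ∧ ∀ (e : Finset ι) (a b : ι), e.card = k → a ∈ e → b ∈ e → a ≠ b →
      edgeWeight k α (ind e + (Pi.single a p + Pi.single b q)) = c := by
  obtain ⟨c, hc, h⟩ := exists_pos_const
    (P := fun x : Finset ι × ι × ι => x.1.card = k ∧ x.2.1 ∈ x.1 ∧ x.2.2 ∈ x.1 ∧ x.2.1 ≠ x.2.2)
    (f := fun x => edgeWeight k α (ind x.1 + (Pi.single x.2.1 p + Pi.single x.2.2 q)))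
    (fun ⟨e, a, b⟩ ⟨he, ha, hb, hab⟩ => edgeWeight_pos (by omega) hα₀ hα₁ (by
      rw [supp_ind_add, he]
      intro i hi
      by_cases h1 : i = a
      · exact h1 ▸ ha
      · by_cases h2 : i = b
        · exact h2 ▸ hb
        · simp [h1, h2] at hi))
    (fun ⟨e, a, b⟩ ⟨f, c, d⟩ ⟨he, ha, hb, hab⟩ ⟨hf, hc, hd, hcd⟩ =>
      edgeWeight_ind_eq (he.trans hf.symm) ha hb hab hc hd hcd k p q α)
  exact ⟨c, hc, fun e a b he ha hb hab => h (e, a, b) ⟨he, ha, hb, hab⟩⟩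

theorem exists_edgeWeight_single_eq (ι : Type*) [Fintype ι] [DecidableEq ι] {k : ℕ} (hk : 2 ≤ k)
    {α : ℝ} (hα₀ : 0 < α) (hα₁ : α < 1) (p : ℕ) :
    ∃ c, ∀ (e : Finset ι) (a : ι), e.card = k → a ∈ e →
      edgeWeight k α (ind e + Pi.single a p) = c := by
  obtain ⟨c, -, h⟩ := exists_edgeWeight_eq ι hk hα₀ hα₁ p 0
  refine ⟨c, fun e a he ha => ?_⟩
  obtain ⟨b, hb, hba⟩ := Finset.exists_mem_ne (show 1 < e.card by omega) a
  rw [← h e a b he ha hb hba.symm, Pi.single_zero, add_zero]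

theorem trace_zero_eq (k : ℕ) (T T' : RTensor ι k) : T.trace 0 = T'.trace 0 := by
  simp [trace_eq_sum_pairing]

omit [Fintype ι] in
theorem prod_pow_ind_add {e : Finset ι} {l : ι → ℕ} (x : ι → ℝ) :
    ∏ i ∈ e, x i ^ ((ind e + l) i - 1) = ∏ i ∈ e, x i ^ l i := by
  refine Finset.prod_congr rfl fun i hi => ?_
  simp [ind, hi]

omit [Fintype ι] in
theorem prod_pow_single {e : Finset ι} {u : ι} (hu : u ∈ e) (x : ι → ℝ) :
    ∏ i ∈ e, x i ^ (Pi.single u 1 : ι → ℕ) i = x u := by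
  rw [Finset.prod_eq_single u (fun i _ hi => by simp [hi]) (fun h => absurd hu h)]
  simp

/-- The part of the trace of order `k + 1` that belongs to a hyperedge. -/
theorem sum_edge_one {e : Finset ι} {k : ℕ} {α A : ℝ} (x : ι → ℝ)
    (hA : ∀ a ∈ e, edgeWeight k α (ind e + Pi.single a 1) = A) :
    ∑ l ∈ e.piAntidiag 1, edgeWeight k α (ind e + l) * ∏ i ∈ e, x i ^ l i = A * ∑ v ∈ e, x v := by
  have h := succ_mul_sum_piAntidiag_succ e 0
    fun l => edgeWeight k α (ind e + l) * ∏ i ∈ e, x i ^ l i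
  simp only [zero_add, Nat.cast_one, one_mul, Finset.piAntidiag_zero, Finset.sum_singleton,
    Pi.zero_apply, Nat.cast_zero] at h
  rw [h, Finset.mul_sum]
  refine Finset.sum_congr rfl fun u hu => ?_
  rw [hA u hu, prod_pow_single hu]

/-- The part of the trace of order `k + 2` that belongs to a hyperedge. -/
theorem sum_edge_two {e : Finset ι} {k : ℕ} {α A B : ℝ} (x : ι → ℝ)
    (hA : ∀ a ∈ e, edgeWeight k α (ind e + Pi.single a 2) = A)
    (hB : ∀ a ∈ e, ∀ b ∈ e, a ≠ b →
      edgeWeight k α (ind e + (Pi.single a 1 + Pi.single b 1)) = B) :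
    ∑ l ∈ e.piAntidiag 2, edgeWeight k α (ind e + l) * ∏ i ∈ e, x i ^ l i =
      (A - B / 2) * ∑ v ∈ e, x v ^ 2 + B / 2 * (∑ v ∈ e, x v) ^ 2 := by
  have h := succ_mul_sum_piAntidiag_succ e 1
    fun l => edgeWeight k α (ind e + l) * ∏ i ∈ e, x i ^ l i
  -- A second marked unit is removed at v. For v = u the factor l u + 1 is 2, so the diagonal term
  -- is 2A x_u², written as B x_u² plus a correction.
  have h1 : ∀ u ∈ e, ∑ l ∈ (e.piAntidiag 1 : Finset (ι → ℕ)), ((l u : ℝ) + 1) *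
      (edgeWeight k α (ind e + (l + Pi.single u 1)) *
        ∏ i ∈ e, x i ^ (l + Pi.single u 1 : ι → ℕ) i) =
      ∑ v ∈ e, (B * (x v * x u) + if v = u then (2 * A - B) * x u ^ 2 else 0) := by
    intro u hu
    have h2 := succ_mul_sum_piAntidiag_succ e 0 fun l : ι → ℕ => ((l u : ℝ) + 1) *
      (edgeWeight k α (ind e + (l + Pi.single u 1)) *
        ∏ i ∈ e, x i ^ (l + Pi.single u 1 : ι → ℕ) i)
    simp only [zero_add, Nat.cast_one, one_mul, Finset.piAntidiag_zero, Finset.sum_singleton,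
      Pi.zero_apply, Nat.cast_zero] at h2
    rw [h2]
    refine Finset.sum_congr rfl fun v hv => ?_
    simp only [Pi.add_apply, pow_add, Finset.prod_mul_distrib, prod_pow_single hu,
      prod_pow_single hv]
    by_cases hvu : v = u
    · subst hvu
      rw [← Pi.single_add, hA v hv]
      simp
      ring
    · rw [hB v hv u hu hvu]
      simp [hvu, Ne.symm hvu]
  rw [Finset.sum_congr rfl h1] at h
  simp only [Finset.sum_add_distrib, ← Finset.mul_sum, ← Finset.sum_mul, Finset.sum_ite_eq'] at h
  rw [Finset.sum_congr rfl fun u (hu : u ∈ e) => if_pos hu, ← Finset.mul_sum] at h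
  push_cast at h
  linarith

/-- The traces of order at most `k + 2` of the tensor of a linear `k`-uniform family. -/
theorem exists_trace_formula (ι : Type*) [Fintype ι] [DecidableEq ι] [Nonempty ι] {k : ℕ}
    (hk : 3 ≤ k) {α : ℝ} (hα₀ : 0 < α) (hα₁ : α < 1) :
    ∃ (κ : ℕ → ℝ) (A₀ A₁ A₂ B : ℝ), (∀ d, 0 < κ d) ∧ 0 < B ∧ ∀ E : Finset (Finset ι),
      (∀ e ∈ E, e.card = k) → (∀ e ∈ E, ∀ f ∈ E, e ≠ f → (e ∩ f).card ≤ 1) →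
        (∀ d, d ≠ 0 → d < k →
          (familyTensor E k α).trace d = κ d * ∑ i, (familyDegree E i : ℝ) ^ d) ∧
        (familyTensor E k α).trace k = κ k * ∑ i, (familyDegree E i : ℝ) ^ k + A₀ * E.card ∧
        (familyTensor E k α).trace (k + 1) = κ (k + 1) * ∑ i, (familyDegree E i : ℝ) ^ (k + 1) +
          A₁ * ∑ e ∈ E, ∑ v ∈ e, (familyDegree E v : ℝ) ∧
        (familyTensor E k α).trace (k + 2) = κ (k + 2) * ∑ i, (familyDegree E i : ℝ) ^ (k + 2) +
          A₂ * (∑ e ∈ E, ∑ v ∈ e, (familyDegree E v : ℝ) ^ 2) +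
            B * ∑ e ∈ E, (∑ v ∈ e, (familyDegree E v : ℝ)) ^ 2 := by
  obtain ⟨A₀, hA₀⟩ := exists_edgeWeight_single_eq ι (by omega : 2 ≤ k) hα₀ hα₁ 0
  obtain ⟨A₁, hA₁⟩ := exists_edgeWeight_single_eq ι (by omega : 2 ≤ k) hα₀ hα₁ 1
  obtain ⟨A₂, hA₂⟩ := exists_edgeWeight_single_eq ι (by omega : 2 ≤ k) hα₀ hα₁ 2
  obtain ⟨B, hBpos, hB⟩ := exists_edgeWeight_eq ι (by omega : 2 ≤ k) hα₀ hα₁ 1 1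
  set c : ℝ := ((k : ℝ) - 1) ^ (Fintype.card ι - 1)
  have hc : 0 < c := by
    have : (3 : ℝ) ≤ k := by exact_mod_cast hk
    exact pow_pos (by linarith) _
  let i₀ : ι := Classical.arbitrary ι
  -- The last two constants are those of `sum_edge_two`. Only the sign of B matters, since the sums
  -- multiplied by A₀, A₁, A₂ coincide when orders k to k + 2 are compared.
  refine ⟨fun d => c * (loopWeight k d i₀ * α ^ d), c * A₀, c * A₁, c * (A₂ - B / 2), c * (B / 2),
    fun d => mul_pos hc (mul_pos (loopWeight_pos _ _ _) (pow_pos hα₀ _)), by positivity,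
    fun E hE hlin => ?_⟩
  have hloop : ∀ d, ∑ i, loopWeight k d i * (α * familyDegree E i) ^ d =
      loopWeight k d i₀ * α ^ d * ∑ i, (familyDegree E i : ℝ) ^ d := by
    intro d
    rw [Finset.mul_sum]
    refine Finset.sum_congr rfl fun i _ => ?_
    rw [loopWeight_eq k d i i₀]
    ring
  have hedge : ∀ r, r ≤ 2 → (familyTensor E k α).trace (k + r) =
      c * (loopWeight k (k + r) i₀ * α ^ (k + r)) * ∑ i, (familyDegree E i : ℝ) ^ (k + r) +
        c * ∑ e ∈ E, ∑ l ∈ e.piAntidiag r,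
          edgeWeight k α (ind e + l) * ∏ i ∈ e, (familyDegree E i : ℝ) ^ l i := by
    intro r hr
    rw [trace_familyTensor hk hE hlin α (by omega) (by omega), hloop]
    have : ∀ e ∈ E, ∑ D ∈ Finset.piAntidiag Finset.univ (k + r) with supp D = e,
          edgeWeight k α D * ∏ i ∈ e, (familyDegree E i : ℝ) ^ (D i - 1) =
        ∑ l ∈ e.piAntidiag r,
          edgeWeight k α (ind e + l) * ∏ i ∈ e, (familyDegree E i : ℝ) ^ l i := by
      intro e he
      rw [sum_filter_supp_eq (hE e he)]
      simp only [prod_pow_ind_add]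
    rw [Finset.sum_congr rfl this]
    ring
  refine ⟨fun d hd hdk => ?_, ?_, ?_, ?_⟩
  · rw [trace_familyTensor hk hE hlin α hd (by omega), hloop, Finset.sum_eq_zero (s := E)]
    · ring
    · intro e he
      rw [Finset.sum_eq_zero]
      intro D hD
      simp only [Finset.mem_filter, Finset.mem_piAntidiag] at hD
      have h1 : e.card ≤ ∑ i, D i := by
        rw [Finset.card_eq_sum_ones]
        refine (Finset.sum_le_sum fun i hi => ?_).trans
          (Finset.sum_le_sum_of_subset (Finset.subset_univ e))
        rw [← hD.2, mem_supp] at hi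
        omega
      rw [hE e he] at h1
      have h2 : ∑ i, D i = d := hD.1.1
      omega
  · have h := hedge 0 (by omega)
    rw [add_zero] at h
    rw [h]
    congr 1
    have : ∀ e ∈ E, ∑ l ∈ e.piAntidiag 0,
        edgeWeight k α (ind e + l) * ∏ i ∈ e, (familyDegree E i : ℝ) ^ l i = A₀ := by
      intro e he
      obtain ⟨a, ha⟩ : e.Nonempty := by rw [← Finset.card_pos, hE e he]; omega
      rw [← hA₀ e a (hE e he) ha]
      simp
    rw [Finset.sum_congr rfl this]
    simp
    ring
  · rw [hedge 1 (by omega), Finset.sum_congr rfl fun e he =>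
      sum_edge_one _ fun a ha => hA₁ e a (hE e he) ha, ← Finset.mul_sum]
    ring
  · rw [hedge 2 (by omega), Finset.sum_congr rfl fun e he =>
      sum_edge_two _ (fun a ha => hA₂ e a (hE e he) ha)
        fun a ha b hb hab => hB e a b (hE e he) ha hb hab, Finset.sum_add_distrib,
      ← Finset.mul_sum, ← Finset.mul_sum]
    ring

end RTensor

/-! ### Unicyclic graphs -/

namespace SimpleGraph

variable {V : Type*} {G : SimpleGraph V}

theorem card_edgeSet_deleteEdges_singleton [Finite V] {e : Sym2 V} (he : e ∈ G.edgeSet) :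
    Nat.card (G.deleteEdges {e}).edgeSet + 1 = Nat.card G.edgeSet := by
  rw [edgeSet_deleteEdges]
  exact Set.ncard_sdiff_singleton_add_one he (Set.toFinite _)

theorem Walk.IsCycle.toSubgraph_le_of_edges_subset {x y : V} {c : G.Walk x x} {c' : G.Walk y y}
    (hc : c.IsCycle) (h : ∀ e ∈ c.edges, e ∈ c'.edges) : c.toSubgraph ≤ c'.toSubgraph := by
  rw [Walk.toSubgraph_le_iff hc.not_nil]
  intro e he
  rw [Walk.edgeSet_toSubgraph]
  exact h e he

theorem Connected.deleteEdges_of_mem_cycle (hG : G.Connected) {e : Sym2 V} {x : V}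
    {c : G.Walk x x} (hc : c.IsCycle) (he : e ∈ c.edges) : (G.deleteEdges {e}).Connected := by
  induction e with
  | _ a b => exact hG.connected_delete_edge_of_not_isBridge fun h => h.notMem_edges_of_isCycle hc he

/-- A connected graph has exactly one cycle if and only if it has as many edges as vertices. -/
theorem Connected.existsUnique_cycle_iff [Finite V] (hG : G.Connected) :
    (∃! C : G.Subgraph, ∃ (x : V) (c : G.Walk x x), c.IsCycle ∧ c.toSubgraph = C) ↔
      Nat.card G.edgeSet = Nat.card V := by
  constructor
  · rintro ⟨C, ⟨x, c, hc, rfl⟩, huniq⟩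
    obtain ⟨e, he⟩ := List.exists_mem_of_ne_nil c.edges (by
      intro h
      exact hc.not_nil (Walk.edges_eq_nil.1 h))
    -- A cycle avoiding e would be a second cycle of G.
    have htree : (G.deleteEdges {e}).IsTree := by
      refine ⟨hG.deleteEdges_of_mem_cycle hc he, fun y c' hc' => ?_⟩
      have hle : G.deleteEdges {e} ≤ G := G.deleteEdges_le {e}
      have h := huniq _ ⟨y, c'.mapLe hle, hc'.mapLe hle, rfl⟩
      have h1 : e ∈ (c'.mapLe hle).toSubgraph.edgeSet := by
        rw [h, Walk.mem_edges_toSubgraph]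
        exact he
      rw [Walk.mem_edges_toSubgraph, Walk.edges_mapLe_eq_edges] at h1
      have h2 := c'.edges_subset_edgeSet h1
      rw [edgeSet_deleteEdges] at h2
      exact h2.2 rfl
    rw [← card_edgeSet_deleteEdges_singleton (c.edges_subset_edgeSet he)]
    exact (isTree_iff_connected_and_card.1 htree).2
  · intro hcard
    -- If e lay on c but not on c', then deleting e would leave a connected graph with |V| - 1
    -- edges, a tree, in which c' survives.
    have hsub : ∀ {x y : V} {c : G.Walk x x} {c' : G.Walk y y}, c.IsCycle → c'.IsCycle →
        ∀ e ∈ c.edges, e ∈ c'.edges := by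
      intro x y c c' hc hc' e he
      by_contra hne
      have htree : (G.deleteEdges {e}).IsTree := by
        refine isTree_iff_connected_and_card.2 ⟨hG.deleteEdges_of_mem_cycle hc he, ?_⟩
        rw [card_edgeSet_deleteEdges_singleton (c.edges_subset_edgeSet he), hcard]
      have hmem : ∀ f ∈ c'.edges, f ∈ (G.deleteEdges {e}).edgeSet := by
        intro f hf
        rw [edgeSet_deleteEdges]
        exact ⟨c'.edges_subset_edgeSet hf, fun h => hne (h ▸ hf)⟩
      exact htree.isAcyclic _ (hc'.transfer hmem)
    have hcyc : ¬ G.IsAcyclic := by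
      intro h
      have := (isTree_iff_connected_and_card.1 ⟨hG, h⟩).2
      omega
    simp only [IsAcyclic, not_forall, not_not] at hcyc
    obtain ⟨x, c, hc⟩ := hcyc
    refine ⟨_, ⟨x, c, hc, rfl⟩, ?_⟩
    rintro _ ⟨y, c', hc', rfl⟩
    exact le_antisymm (hc'.toSubgraph_le_of_edges_subset (hsub hc' hc))
      (hc.toSubgraph_le_of_edges_subset (hsub hc hc'))

end SimpleGraph

/-! ### The incidence graph and the counting criterion for unicyclic hypergraphs -/

namespace Hypergraph

variable {β : Type*} {H : Hypergraph β}

theorem incidenceGraph_adj_inl_inr {v : H.vertexSet} {e : H.edgeSet} :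
    H.incidenceGraph.Adj (Sum.inl v) (Sum.inr e) ↔ (v : β) ∈ (e : Set β) := by
  simp [incidenceGraph]

theorem incidenceGraph_adj_inr_inl {v : H.vertexSet} {e : H.edgeSet} :
    H.incidenceGraph.Adj (Sum.inr e) (Sum.inl v) ↔ (v : β) ∈ (e : Set β) := by
  rw [SimpleGraph.adj_comm, incidenceGraph_adj_inl_inr]

theorem not_incidenceGraph_adj_inl_inl {v w : H.vertexSet} :
    ¬ H.incidenceGraph.Adj (Sum.inl v) (Sum.inl w) := by
  simp [incidenceGraph]

theorem not_incidenceGraph_adj_inr_inr {e f : H.edgeSet} :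
    ¬ H.incidenceGraph.Adj (Sum.inr e) (Sum.inr f) := by
  simp [incidenceGraph]

theorem subset_vertexSet {e : Set β} (he : e ∈ H.edgeSet) : e ⊆ H.vertexSet :=
  H.subset_vertexSet_of_mem_edgeSet' he

theorem IsConnected.incidenceGraph_connected (h : H.IsConnected)
    (hne : ∀ e ∈ H.edgeSet, e.Nonempty) : H.incidenceGraph.Connected := by
  obtain ⟨v, hv⟩ := h.1
  refine (SimpleGraph.connected_iff_exists_forall_reachable _).2 ⟨Sum.inl ⟨v, hv⟩, ?_⟩
  rintro (w | ⟨e, he⟩)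
  · exact h.2 _ _
  · obtain ⟨w, hw⟩ := hne e he
    exact (h.2 ⟨v, hv⟩ ⟨w, subset_vertexSet he hw⟩).trans
      (SimpleGraph.Adj.reachable (incidenceGraph_adj_inl_inr.2 hw))

/-- The incidences of a hypergraph are the edges of its incidence graph. -/
noncomputable def incidenceEquiv (H : Hypergraph β) :
    (Σ e : H.edgeSet, {v : H.vertexSet // (v : β) ∈ (e : Set β)}) ≃ H.incidenceGraph.edgeSet :=
  Equiv.ofBijective
    (fun p => ⟨s(Sum.inl p.2.1, Sum.inr p.1), incidenceGraph_adj_inl_inr.2 p.2.2⟩) (by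
      constructor
      · rintro ⟨e, v, hv⟩ ⟨f, w, hw⟩ h
        have h' := Sym2.eq_iff.1 (Subtype.ext_iff.1 h)
        simp only [Sum.inl.injEq, Sum.inr.injEq, reduceCtorEq, and_self, or_false] at h'
        obtain ⟨rfl, rfl⟩ := h'
        rfl
      · rintro ⟨x, hx⟩
        induction x with
        | _ a b =>
          rcases a with v | e <;> rcases b with w | f
          · exact absurd hx not_incidenceGraph_adj_inl_inl
          · exact ⟨⟨f, v, incidenceGraph_adj_inl_inr.1 hx⟩, rfl⟩
          · exact ⟨⟨e, w, incidenceGraph_adj_inr_inl.1 hx⟩, Subtype.ext Sym2.eq_swap⟩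
          · exact absurd hx not_incidenceGraph_adj_inr_inr)

theorem card_edgeSet_incidenceGraph [Finite H.vertexSet] [Finite H.edgeSet] {k : ℕ}
    (h : H.IsUniform k) : Nat.card H.incidenceGraph.edgeSet = H.edgeSet.ncard * k := by
  have := Fintype.ofFinite H.edgeSet
  rw [← Nat.card_congr H.incidenceEquiv, Nat.card_sigma]
  have hcard : ∀ e : H.edgeSet, Nat.card {v : H.vertexSet // (v : β) ∈ (e : Set β)} = k := by
    intro e
    rw [← h e e.2, ← Nat.card_coe_set_eq]
    exact Nat.card_congr ⟨fun v => ⟨v.1, v.2⟩, fun v => ⟨⟨v, subset_vertexSet e.2 v.2⟩, v.2⟩,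
      fun _ => rfl, fun _ => rfl⟩
  rw [Finset.sum_congr rfl fun e _ => hcard e, Finset.sum_const, smul_eq_mul, Finset.card_univ, ← Nat.card_eq_fintype_card,
    Nat.card_coe_set_eq]

theorem finite_edgeSet [Finite H.vertexSet] : Finite H.edgeSet :=
  (Set.Finite.finite_subsets (Set.toFinite H.vertexSet)).subset fun _ he => subset_vertexSet he

/-- The incidence graph has |V| + |E| vertices and, by uniformity, k|E| edges. -/
theorem IsConnected.isUnicyclic_iff [Finite H.vertexSet] (h : H.IsConnected) {k : ℕ} (hk : 1 ≤ k)
    (hu : H.IsUniform k) :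
    H.IsUnicyclic ↔ H.edgeSet.ncard * k = Nat.card H.vertexSet + H.edgeSet.ncard := by
  have := H.finite_edgeSet
  have hne : ∀ e ∈ H.edgeSet, e.Nonempty := fun e he => by
    rw [Set.nonempty_iff_ne_empty]
    rintro rfl
    have := hu _ he
    simp at this
    omega
  rw [IsUnicyclic, and_iff_right h, (h.incidenceGraph_connected hne).existsUnique_cycle_iff,
    card_edgeSet_incidenceGraph hu, Nat.card_sum, Nat.card_coe_set_eq H.edgeSet]

end Hypergraph

/-! ### Comparison of the traces of two families of hyperedges -/

namespace RTensor

variable {ι κ : Type*} [Fintype ι] [DecidableEq ι] [Fintype κ] [DecidableEq κ]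

-- Used with f = 1, deg and deg²: sums over incidences become power sums of the degrees.
omit [Fintype ι] in
theorem sum_sum_family (E : Finset (Finset ι)) (s : Finset ι) (hs : ∀ e ∈ E, e ⊆ s) (f : ι → ℝ) :
    ∑ e ∈ E, ∑ v ∈ e, f v = ∑ v ∈ s, (familyDegree E v : ℝ) * f v := by
  have h : ∀ e ∈ E, ∑ v ∈ e, f v = ∑ v ∈ s, if v ∈ e then f v else 0 := by
    intro e he
    rw [← Finset.sum_filter]
    refine Finset.sum_congr ?_ fun _ _ => rfl
    ext v
    simp only [Finset.mem_filter]
    exact ⟨fun hv => ⟨hs e he hv, hv⟩, fun hv => hv.2⟩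
  rw [Finset.sum_congr rfl h, Finset.sum_comm]
  refine Finset.sum_congr rfl fun v _ => ?_
  rw [← Finset.sum_filter, Finset.sum_const, nsmul_eq_mul, familyDegree]

omit [Fintype ι] [Fintype κ] in
theorem familyTensor_comp (ψ : ι ≃ κ) {E : Finset (Finset ι)} {F : Finset (Finset κ)}
    (h : ∀ s, s ∈ E ↔ s.map ψ.toEmbedding ∈ F) (k : ℕ) (α : ℝ) :
    familyTensor E k α = fun i a => familyTensor F k α (ψ i) (ψ ∘ a) := by
  have hdeg : ∀ i, familyDegree E i = familyDegree F (ψ i) := by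
    intro i
    refine Finset.card_bij (fun s _ => s.map ψ.toEmbedding) ?_ ?_ ?_
    · intro s hs
      simp only [Finset.mem_filter] at hs ⊢
      exact ⟨(h s).1 hs.1, by simpa using hs.2⟩
    · intro s _ t _ hst
      exact Finset.map_injective _ hst
    · intro t ht
      have : (t.map ψ.symm.toEmbedding).map ψ.toEmbedding = t := by
        ext x; simp
      simp only [Finset.mem_filter] at ht
      refine ⟨t.map ψ.symm.toEmbedding, ?_, this⟩
      simp only [Finset.mem_filter, h, this]
      exact ⟨ht.1, by simpa using ht.2⟩
  funext i a
  simp only [familyTensor, hdeg, Function.comp_apply, ψ.apply_eq_iff_eq]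
  congr 3
  rw [h]
  congr 1
  ext x
  simp only [Finset.mem_map_equiv, Finset.mem_insert, Finset.mem_image, Finset.mem_univ, true_and,
    Function.comp_apply, ψ.symm_apply_eq, Equiv.eq_symm_apply]

/-- Among families with the same number of hyperedges, the traces single out the families in which
every vertex has degree at most `2` and every hyperedge has degree sum `k + 2`. -/
theorem trace_familyTensor_lt_or {E F : Finset (Finset ι)} {k : ℕ} (hk : 3 ≤ k) {α : ℝ}
    (hα₀ : 0 < α) (hα₁ : α < 1)
    (hE : ∀ e ∈ E, e.card = k) (hElin : ∀ e ∈ E, ∀ f ∈ E, e ≠ f → (e ∩ f).card ≤ 1)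
    (hF : ∀ e ∈ F, e.card = k) (hFlin : ∀ e ∈ F, ∀ f ∈ F, e ≠ f → (e ∩ f).card ≤ 1)
    (hcard : E.card = F.card) (hEdeg : ∀ i, 1 ≤ familyDegree E i)
    (hFdeg : ∀ i, familyDegree F i = 1 ∨ familyDegree F i = 2)
    (hFsum : ∀ e ∈ F, ∑ v ∈ e, familyDegree F v = k + 2) :
    (∃ d, (d = 2 ∨ d = k + 2) ∧
      (∀ t < d, (familyTensor F k α).trace t = (familyTensor E k α).trace t) ∧
        (familyTensor F k α).trace d < (familyTensor E k α).trace d) ∨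
    (∀ i, familyDegree E i = 1 ∨ familyDegree E i = 2) ∧
      ∀ e ∈ E, ∑ v ∈ e, familyDegree E v = k + 2 := by
  rcases isEmpty_or_nonempty ι with hι | hι
  · refine Or.inr ⟨fun i => (IsEmpty.false i).elim, fun e he => ?_⟩
    have := hE e he
    rw [Finset.eq_empty_of_isEmpty e] at this
    simp at this
    omega
  obtain ⟨κ, A₀, A₁, A₂, B, hκ, hB, hform⟩ := exists_trace_formula ι hk hα₀ hα₁
  obtain ⟨hE1, hE2, hE3, hE4⟩ := hform E hE hElin
  obtain ⟨hF1, hF2, hF3, hF4⟩ := hform F hF hFlin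
  have hsub : ∀ (G : Finset (Finset ι)), ∀ e ∈ G, e ⊆ Finset.univ := fun _ _ _ =>
    Finset.subset_univ _
  have hsum : ∀ G : Finset (Finset ι), (∀ e ∈ G, e.card = k) →
      ∑ i, (familyDegree G i : ℝ) = G.card * k := by
    intro G hG
    have h := sum_sum_family G Finset.univ (hsub G) fun _ => 1
    simp only [mul_one] at h
    rw [← h, Finset.sum_congr rfl fun e he => by
      rw [Finset.sum_const, hG e he, nsmul_eq_mul, mul_one], Finset.sum_const, nsmul_eq_mul]
  have hsumEF : ∑ i, (familyDegree F i : ℝ) = ∑ i, (familyDegree E i : ℝ) := by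
    rw [hsum E hE, hsum F hF, hcard]
  -- As the number of vertices and the degree sum are shared, comparing Σ deg² is comparing Σ (deg -
  -- 1)(deg - 2), which is zero for F and nonnegative for E.
  have hquad : ∀ G : Finset (Finset ι),
      ∑ i, ((familyDegree G i : ℝ) - 1) * ((familyDegree G i : ℝ) - 2) =
        ∑ i, (familyDegree G i : ℝ) ^ 2 - 3 * ∑ i, (familyDegree G i : ℝ) +
          2 * Fintype.card ι := by
    intro G
    rw [Finset.mul_sum, ← Finset.sum_sub_distrib, ← nsmul_one (Fintype.card ι),
      ← Finset.card_univ, ← Finset.sum_const, Finset.mul_sum, ← Finset.sum_add_distrib]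
    exact Finset.sum_congr rfl fun i _ => by ring
  have hFquad : ∑ i, ((familyDegree F i : ℝ) - 1) * ((familyDegree F i : ℝ) - 2) = 0 :=
    Finset.sum_eq_zero fun i _ => by rcases hFdeg i with h | h <;> rw [h] <;> norm_num
  have hterm : ∀ i, 0 ≤ ((familyDegree E i : ℝ) - 1) * ((familyDegree E i : ℝ) - 2) := by
    intro i
    rcases (hEdeg i).eq_or_lt with h | h
    · rw [← h]; norm_num
    · have h2 : (2 : ℝ) ≤ familyDegree E i := by exact_mod_cast h
      exact mul_nonneg (by linarith) (by linarith)
  have ht0 := trace_zero_eq k (familyTensor F k α) (familyTensor E k α)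
  by_cases hdeg : ∀ i, familyDegree E i = 1 ∨ familyDegree E i = 2
  swap
  · left
    refine ⟨2, Or.inl rfl, ?_, ?_⟩
    · intro t ht
      interval_cases t
      · exact ht0
      · rw [hE1 1 one_ne_zero (by omega), hF1 1 one_ne_zero (by omega)]
        simp only [pow_one, hsumEF]
    · rw [hE1 2 two_ne_zero (by omega), hF1 2 two_ne_zero (by omega)]
      refine mul_lt_mul_of_pos_left ?_ (hκ 2)
      have h1 := hquad E
      have h2 := hquad F
      have h3 : 0 < ∑ i, ((familyDegree E i : ℝ) - 1) * ((familyDegree E i : ℝ) - 2) := by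
        push Not at hdeg
        obtain ⟨i, hi⟩ := hdeg
        refine Finset.sum_pos' (fun i _ => hterm i) ⟨i, Finset.mem_univ i, ?_⟩
        have h4 := hEdeg i
        have h5 : (3 : ℝ) ≤ familyDegree E i := by exact_mod_cast (by omega : 3 ≤ familyDegree E i)
        exact mul_pos (by linarith) (by linarith)
      linarith
  -- On {1, 2} the function x^t agrees with the affine function (2^t - 1) x + (2 - 2^t), so every
  -- power sum is determined by the degree sum and the number of vertices.
  have hpow : ∀ t, ∑ i, (familyDegree F i : ℝ) ^ t = ∑ i, (familyDegree E i : ℝ) ^ t := by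
    intro t
    have h : ∀ G : Finset (Finset ι), (∀ i, familyDegree G i = 1 ∨ familyDegree G i = 2) →
        ∑ i, (familyDegree G i : ℝ) ^ t =
          (2 ^ t - 1) * ∑ i, (familyDegree G i : ℝ) + (2 - 2 ^ t) * Fintype.card ι := by
      intro G hG
      rw [← nsmul_one (Fintype.card ι), ← Finset.card_univ, ← Finset.sum_const, Finset.mul_sum,
        Finset.mul_sum, ← Finset.sum_add_distrib]
      refine Finset.sum_congr rfl fun i _ => ?_
      rcases hG i with h | h <;> rw [h]
      · norm_num
      · push_cast; ring
    rw [h E hdeg, h F hFdeg, hsumEF]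
  have hlow : ∀ t < k + 2, (familyTensor F k α).trace t = (familyTensor E k α).trace t := by
    intro t ht
    rcases Nat.eq_zero_or_pos t with rfl | ht0'
    · exact ht0
    · rcases lt_or_ge t k with h | h
      · rw [hE1 t (by omega) h, hF1 t (by omega) h, hpow]
      · obtain rfl | rfl : t = k ∨ t = k + 1 := by omega
        · rw [hE2, hF2, hpow, hcard]
        · rw [hE3, hF3, hpow, sum_sum_family E _ (hsub E), sum_sum_family F _ (hsub F)]
          simp only [← pow_two, hpow]
  have hcube : ∑ e ∈ F, ∑ v ∈ e, (familyDegree F v : ℝ) ^ 2 =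
      ∑ e ∈ E, ∑ v ∈ e, (familyDegree E v : ℝ) ^ 2 := by
    rw [sum_sum_family E _ (hsub E), sum_sum_family F _ (hsub F)]
    simp only [← pow_succ', hpow]
  have hlin : ∑ e ∈ F, ∑ v ∈ e, (familyDegree F v : ℝ) =
      ∑ e ∈ E, ∑ v ∈ e, (familyDegree E v : ℝ) := by
    rw [sum_sum_family E _ (hsub E), sum_sum_family F _ (hsub F)]
    simp only [← pow_two, hpow]
  -- Completing the square at the mean value k + 2: the linear term and the number of hyperedges
  -- agree for E and F, so only the squares are compared.
  have hsq : ∀ G : Finset (Finset ι),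
      ∑ e ∈ G, (∑ v ∈ e, (familyDegree G v : ℝ) - (k + 2)) ^ 2 =
        ∑ e ∈ G, (∑ v ∈ e, (familyDegree G v : ℝ)) ^ 2 -
          2 * (k + 2) * ∑ e ∈ G, ∑ v ∈ e, (familyDegree G v : ℝ) + (k + 2) ^ 2 * G.card := by
    intro G
    rw [Finset.mul_sum, ← Finset.sum_sub_distrib, ← nsmul_one G.card, ← Finset.sum_const,
      Finset.mul_sum, ← Finset.sum_add_distrib]
    exact Finset.sum_congr rfl fun i _ => by ring
  have hsqF : ∑ e ∈ F, (∑ v ∈ e, (familyDegree F v : ℝ) - (k + 2)) ^ 2 = 0 :=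
    Finset.sum_eq_zero fun e he => by
      rw [← Nat.cast_sum, hFsum e he]
      push_cast
      ring
  by_cases hall : ∀ e ∈ E, ∑ v ∈ e, familyDegree E v = k + 2
  · exact Or.inr ⟨hdeg, hall⟩
  left
  refine ⟨k + 2, Or.inr rfl, hlow, ?_⟩
  rw [hE4, hF4, hpow, hcube]
  have h1 := hsq E
  have h2 := hsq F
  rw [hsqF, hlin] at h2
  rw [hcard] at h1
  have h3 : 0 < ∑ e ∈ E, (∑ v ∈ e, (familyDegree E v : ℝ) - (k + 2)) ^ 2 := by
    push Not at hall
    obtain ⟨e, he, hne⟩ := hall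
    refine Finset.sum_pos' (fun _ _ => sq_nonneg _) ⟨e, he, ?_⟩
    have : ∑ v ∈ e, (familyDegree E v : ℝ) - (k + 2) ≠ 0 := by
      rw [sub_ne_zero]
      exact_mod_cast hne
    positivity
  have h4 : B * ∑ e ∈ F, (∑ v ∈ e, (familyDegree F v : ℝ)) ^ 2 <
      B * ∑ e ∈ E, (∑ v ∈ e, (familyDegree E v : ℝ)) ^ 2 :=
    mul_lt_mul_of_pos_left (by linarith) hB
  linarith

end RTensor

/-! ### The family of hyperedges of a hypergraph with finitely many vertices -/

namespace Hypergraph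

open RTensor

variable {β β₁ β₂ : Type*}

open Classical in
/-- The hyperedges as finsets of vertices. -/
noncomputable def edgeFamily (H : Hypergraph β) [Fintype H.vertexSet] :
    Finset (Finset H.vertexSet) :=
  Finset.univ.filter fun s => Subtype.val '' (s : Set H.vertexSet) ∈ H.edgeSet

section

variable {H : Hypergraph β} [Fintype H.vertexSet]

theorem mem_edgeFamily {s : Finset H.vertexSet} :
    s ∈ H.edgeFamily ↔ Subtype.val '' (s : Set H.vertexSet) ∈ H.edgeSet := by
  simp [edgeFamily]

theorem exists_mem_edgeFamily {e : Set β} (he : e ∈ H.edgeSet) :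
    ∃ s ∈ H.edgeFamily, Subtype.val '' (s : Set H.vertexSet) = e := by
  classical
  have h : Subtype.val '' (((Subtype.val ⁻¹' e : Set H.vertexSet).toFinset : Finset H.vertexSet) :
      Set H.vertexSet) = e := by
    rw [Set.coe_toFinset, Subtype.image_preimage_coe,
      Set.inter_eq_right.2 (subset_vertexSet he)]
  exact ⟨_, mem_edgeFamily.2 (h.symm ▸ he), h⟩

omit [Fintype H.vertexSet] in
theorem image_val_injective :
    Function.Injective fun s : Finset H.vertexSet => Subtype.val '' (s : Set H.vertexSet) :=
  (Set.image_injective.2 Subtype.val_injective).comp Finset.coe_injective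

theorem image_edgeFamily :
    (fun s : Finset H.vertexSet => Subtype.val '' (s : Set H.vertexSet)) '' H.edgeFamily =
      H.edgeSet := by
  ext e
  constructor
  · rintro ⟨s, hs, rfl⟩
    exact mem_edgeFamily.1 hs
  · intro he
    obtain ⟨s, hs, rfl⟩ := exists_mem_edgeFamily he
    exact ⟨s, hs, rfl⟩

theorem card_edgeFamily : H.edgeFamily.card = H.edgeSet.ncard := by
  rw [← image_edgeFamily, Set.ncard_image_of_injective _ image_val_injective,
    Set.ncard_coe_finset]

omit [Fintype H.vertexSet] in
theorem ncard_image_val (s : Finset H.vertexSet) :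
    (Subtype.val '' (s : Set H.vertexSet)).ncard = s.card := by
  rw [Set.ncard_image_of_injective _ Subtype.val_injective, Set.ncard_coe_finset]

theorem IsUniform.card_eq {k : ℕ} (h : H.IsUniform k) : ∀ s ∈ H.edgeFamily, s.card = k :=
  fun s hs => by rw [← ncard_image_val]; exact h _ (mem_edgeFamily.1 hs)

theorem IsLinear.card_inter_le [DecidableEq H.vertexSet] (h : H.IsLinear) :
    ∀ s ∈ H.edgeFamily, ∀ t ∈ H.edgeFamily, s ≠ t → (s ∩ t).card ≤ 1 := by
  intro s hs t ht hst
  rw [Finset.card_le_one]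
  intro a ha b hb
  rw [Finset.mem_inter] at ha hb
  exact Subtype.ext (h _ (mem_edgeFamily.1 hs) _ (mem_edgeFamily.1 ht)
    (fun h' => hst (image_val_injective h'))
    ⟨⟨a, ha.1, rfl⟩, ⟨a, ha.2, rfl⟩⟩ ⟨⟨b, hb.1, rfl⟩, ⟨b, hb.2, rfl⟩⟩)

theorem familyDegree_edgeFamily [DecidableEq H.vertexSet] (v : H.vertexSet) :
    familyDegree H.edgeFamily v = H.degree v := by
  rw [familyDegree, degree, ← Set.ncard_coe_finset,
    ← Set.ncard_image_of_injective _ image_val_injective]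
  congr 1
  ext e
  constructor
  · rintro ⟨s, hs, rfl⟩
    rw [Finset.mem_coe, Finset.mem_filter] at hs
    exact ⟨mem_edgeFamily.1 hs.1, v, hs.2, rfl⟩
  · rintro ⟨he, hv⟩
    obtain ⟨s, hs, rfl⟩ := exists_mem_edgeFamily he
    refine ⟨s, ?_, rfl⟩
    rw [Finset.mem_coe, Finset.mem_filter]
    obtain ⟨w, hw, hwv⟩ := hv
    exact ⟨hs, Subtype.ext hwv ▸ hw⟩

theorem alphaTensor_eq_familyTensor [DecidableEq H.vertexSet] (k : ℕ) (α : ℝ) :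
    H.alphaTensor k α = familyTensor H.edgeFamily k α := by
  funext i a
  simp only [alphaTensor, degreeTensor, adjacencyTensor, familyTensor, Pi.add_apply, Pi.smul_apply,
    smul_eq_mul, familyDegree_edgeFamily]
  congr 3
  rw [mem_edgeFamily, Finset.coe_insert, Finset.coe_image, Finset.coe_univ, Set.image_insert_eq, Set.image_univ,
    ← Set.range_comp]
  rfl

theorem alphaMoment_eq_trace [DecidableEq H.vertexSet] (k : ℕ) (α : ℝ) (d : ℕ) :
    H.alphaMoment k α d = (familyTensor H.edgeFamily k α).trace d := by
  rw [alphaMoment, ← alphaTensor_eq_familyTensor]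
  -- The two sides differ only in the instances of decidable equality.
  congr!

/-- A walk from v to some hyperedge must start by entering a hyperedge that contains v. -/
theorem IsUnicyclic.one_le_degree (h : H.IsUnicyclic) (hne : H.edgeSet.Nonempty)
    (hne' : ∀ e ∈ H.edgeSet, e.Nonempty) (v : H.vertexSet) : 1 ≤ H.degree v := by
  obtain ⟨e, he⟩ := hne
  obtain ⟨p⟩ := (h.1.incidenceGraph_connected hne').preconnected (Sum.inl v) (Sum.inr ⟨e, he⟩)
  have := H.finite_edgeSet
  refine (Set.ncard_pos ((Set.toFinite H.edgeSet).subset fun _ h => h.1)).2 ?_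
  cases p with
  | @cons _ w _ hadj q =>
    rcases w with w | f
    · exact absurd hadj not_incidenceGraph_adj_inl_inl
    · exact ⟨f, f.2, incidenceGraph_adj_inl_inr.1 hadj⟩

end

section

variable {H₁ : Hypergraph β₁} {H₂ : Hypergraph β₂} [Fintype H₁.vertexSet] [Fintype H₂.vertexSet]

theorem IsIsomorphic.alphaEq (h : H₁.IsIsomorphic H₂) (k : ℕ) (α : ℝ) : AlphaEq k α H₁ H₂ := by
  classical
  obtain ⟨ψ, hψ⟩ := h
  refine ⟨Fintype.card_congr ψ, fun t _ => ?_⟩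
  rw [alphaMoment_eq_trace, alphaMoment_eq_trace, ← trace_reindex ψ,
    ← familyTensor_comp ψ (E := H₁.edgeFamily)]
  intro s
  rw [mem_edgeFamily, mem_edgeFamily, hψ, Finset.coe_map]
  rfl

end

end Hypergraph

/-! ### The hypercycle -/

namespace Hypergraph

open RTensor

/-- The `i`-th hyperedge of the hypercycle, as a finset. -/
def cycleEdge (k m : ℕ) (i : Fin m) : Finset (Fin m ⊕ Fin m × Fin (k - 2)) :=
  ({i, finRotate m i} : Finset (Fin m)).disjSum ({i} ×ˢ Finset.univ)

variable {k m : ℕ}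

theorem inl_mem_cycleEdge {i a : Fin m} :
    Sum.inl a ∈ cycleEdge k m i ↔ a = i ∨ a = finRotate m i := by
  simp [cycleEdge]

theorem inr_mem_cycleEdge {i a : Fin m} {j : Fin (k - 2)} :
    Sum.inr (a, j) ∈ cycleEdge k m i ↔ a = i := by
  simp [cycleEdge, eq_comm]

theorem coe_cycleEdge (i : Fin m) : (cycleEdge k m i : Set (Fin m ⊕ Fin m × Fin (k - 2))) =
    {x | x = Sum.inl i ∨ x = Sum.inl (finRotate m i) ∨ ∃ j, x = Sum.inr (i, j)} := by
  ext x
  rcases x with a | ⟨a, j⟩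
  · simp [inl_mem_cycleEdge]
  · simp [inr_mem_cycleEdge]

theorem edgeSet_hypercycle : (hypercycle k m).edgeSet =
    Set.range fun i : Fin m => (cycleEdge k m i : Set (Fin m ⊕ Fin m × Fin (k - 2))) := by
  simp only [coe_cycleEdge]
  rfl

theorem finRotate_ne (hm : 2 ≤ m) (i : Fin m) : finRotate m i ≠ i := by
  obtain ⟨n, rfl⟩ : ∃ n, m = n + 1 := ⟨m - 1, by omega⟩
  intro h
  have := congrArg Fin.val h
  rw [coe_finRotate] at this
  split_ifs at this with h1
  · rw [h1, Fin.val_last] at this; omega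
  · omega

theorem finRotate_finRotate_ne (hm : 3 ≤ m) (i : Fin m) : finRotate m (finRotate m i) ≠ i := by
  obtain ⟨n, rfl⟩ : ∃ n, m = n + 1 := ⟨m - 1, by omega⟩
  intro h
  have h2 := congrArg Fin.val h
  rw [coe_finRotate, coe_finRotate] at h2
  have h0 : (finRotate (n + 1) i).val = if i = Fin.last n then 0 else i.val + 1 := coe_finRotate i
  split_ifs at h2 h0 with h1 h3 h3
  · rw [h1, Fin.val_last] at h0; omega
  · rw [h1, Fin.val_last] at h0; omega
  · rw [h3, Fin.val_last] at h2; omega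
  · omega

theorem card_cycleEdge (hk : 2 ≤ k) (hm : 2 ≤ m) (i : Fin m) : (cycleEdge k m i).card = k := by
  rw [cycleEdge, Finset.card_disjSum, Finset.card_pair (finRotate_ne hm i).symm,
    Finset.card_product]
  simp
  omega

theorem cycleEdge_injective (hk : 3 ≤ k) : Function.Injective (cycleEdge k m) := by
  intro i j h
  have : Sum.inr (i, ⟨0, by omega⟩) ∈ cycleEdge k m i := inr_mem_cycleEdge.2 rfl
  rw [h] at this
  exact inr_mem_cycleEdge.1 this

theorem isUniform_hypercycle (hk : 2 ≤ k) (hm : 2 ≤ m) : (hypercycle k m).IsUniform k := by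
  intro e he
  rw [edgeSet_hypercycle] at he
  obtain ⟨i, rfl⟩ := he
  rw [Set.ncard_coe_finset, card_cycleEdge hk hm]

theorem isLinear_hypercycle (hm : 3 ≤ m) : (hypercycle k m).IsLinear := by
  intro e he f hf hef
  rw [edgeSet_hypercycle] at he hf
  obtain ⟨i, rfl⟩ := he
  obtain ⟨j, rfl⟩ := hf
  have hij : i ≠ j := fun h => hef (by rw [h])
  rintro (x | ⟨x, p⟩) ⟨hx, hx'⟩ (y | ⟨y, q⟩) ⟨hy, hy'⟩ <;>
    simp only [Finset.mem_coe, inl_mem_cycleEdge, inr_mem_cycleEdge] at hx hx' hy hy'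
  · congr 1
    by_contra hxy
    -- Two different common vertices would make i and j successors of each other, which is
    -- impossible for m ≥ 3.
    have h1 : i = finRotate m j ∧ j = finRotate m i := by
      rcases hx with rfl | rfl <;> rcases hx' with h | h
      · exact absurd h hij
      · rcases hy with rfl | rfl
        · exact absurd rfl hxy
        · rcases hy' with h' | h'
          · exact ⟨h, h'.symm⟩
          · exact absurd (h.trans h'.symm) hxy
      · rcases hy with rfl | rfl
        · rcases hy' with h' | h'
          · exact absurd h' hij
          · exact ⟨h', h.symm⟩
        · exact absurd rfl hxy
      · exact absurd ((finRotate m).injective h) hij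
    exact finRotate_finRotate_ne hm i (by rw [← h1.2, ← h1.1])
  · exact absurd (hy.symm.trans hy') hij
  · exact absurd (hx.symm.trans hx') hij
  · exact absurd (hx.symm.trans hx') hij

theorem ncard_edgeSet_hypercycle (hk : 3 ≤ k) : (hypercycle k m).edgeSet.ncard = m := by
  have hinj : Function.Injective
      fun i : Fin m => (cycleEdge k m i : Set (Fin m ⊕ Fin m × Fin (k - 2))) :=
    Finset.coe_injective.comp (cycleEdge_injective hk)
  rw [edgeSet_hypercycle, ← Set.image_univ, Set.ncard_image_of_injective _ hinj, Set.ncard_univ,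
    Nat.card_eq_fintype_card, Fintype.card_fin]

theorem card_vertexSet_hypercycle :
    Fintype.card (hypercycle k m).vertexSet = m + m * (k - 2) := by
  refine (Fintype.card_congr (Equiv.Set.univ _)).trans ?_
  simp

theorem isConnected_hypercycle (hm : 1 ≤ m) : (hypercycle k m).IsConnected := by
  obtain ⟨n, rfl⟩ : ∃ n, m = n + 1 := ⟨m - 1, by omega⟩
  refine ⟨⟨Sum.inl 0, trivial⟩, ?_⟩
  have hadj : ∀ (i : Fin (n + 1)) (x y : (hypercycle k (n + 1)).vertexSet),
      x.1 ∈ cycleEdge k (n + 1) i → y.1 ∈ cycleEdge k (n + 1) i →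
      (hypercycle k (n + 1)).incidenceGraph.Reachable (Sum.inl x) (Sum.inl y) := by
    intro i x y hx hy
    have he : (cycleEdge k (n + 1) i : Set _) ∈ (hypercycle k (n + 1)).edgeSet := by
      rw [edgeSet_hypercycle]; exact ⟨i, rfl⟩
    have h1 : (hypercycle k (n + 1)).incidenceGraph.Adj (Sum.inl x) (Sum.inr ⟨_, he⟩) :=
      incidenceGraph_adj_inl_inr.2 hx
    have h2 : (hypercycle k (n + 1)).incidenceGraph.Adj (Sum.inr ⟨_, he⟩) (Sum.inl y) :=
      incidenceGraph_adj_inr_inl.2 hy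
    exact h1.reachable.trans h2.reachable
  have hu : ∀ i : Fin (n + 1), (hypercycle k (n + 1)).incidenceGraph.Reachable
      (Sum.inl ⟨Sum.inl 0, trivial⟩) (Sum.inl ⟨Sum.inl i, trivial⟩) := by
    intro i
    induction i using Fin.induction with
    | zero => rfl
    | succ i ih =>
      refine ih.trans (hadj i.castSucc _ _ (inl_mem_cycleEdge.2 (Or.inl rfl))
        (inl_mem_cycleEdge.2 (Or.inr ?_)))
      rw [finRotate_apply, Fin.coeSucc_eq_succ]
  have hall : ∀ x : (hypercycle k (n + 1)).vertexSet,
      (hypercycle k (n + 1)).incidenceGraph.Reachable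
        (Sum.inl ⟨Sum.inl 0, trivial⟩) (Sum.inl x) := by
    rintro ⟨i | ⟨i, j⟩, -⟩
    · exact hu i
    · exact (hu i).trans (hadj i _ _ (inl_mem_cycleEdge.2 (Or.inl rfl)) (inr_mem_cycleEdge.2 rfl))
  exact fun x y => (hall x).symm.trans (hall y)

theorem isLinearUnicyclic_hypercycle (hk : 3 ≤ k) (hm : 3 ≤ m) :
    (hypercycle k m).IsLinearUnicyclic k m where
  uniform := isUniform_hypercycle (by omega) (by omega)
  linear := isLinear_hypercycle hm
  unicyclic := by
    -- Uniqueness of the cycle follows from the count mk = (m + m(k-2)) + m, without exhibiting a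
    -- cycle.
    rw [(isConnected_hypercycle (by omega)).isUnicyclic_iff (by omega : 1 ≤ k)
      (isUniform_hypercycle (by omega) (by omega)), Nat.card_eq_fintype_card,
      card_vertexSet_hypercycle, ncard_edgeSet_hypercycle hk]
    obtain ⟨l, rfl⟩ : ∃ l, k = l + 2 := ⟨k - 2, by omega⟩
    rw [Nat.add_sub_cancel]
    ring
  ncard_edgeSet := ncard_edgeSet_hypercycle hk

theorem degree_hypercycle (hk : 3 ≤ k) (x : Fin m ⊕ Fin m × Fin (k - 2)) :
    (hypercycle k m).degree x = (Finset.univ.filter fun i => x ∈ cycleEdge k m i).card := by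
  rw [degree, edgeSet_hypercycle, ← Set.ncard_coe_finset, ← Set.ncard_image_of_injective _
    (Finset.coe_injective.comp (cycleEdge_injective (m := m) hk))]
  congr 1
  ext e
  constructor
  · rintro ⟨⟨i, rfl⟩, hx⟩
    exact ⟨i, by simpa using hx, rfl⟩
  · rintro ⟨i, hx, rfl⟩
    exact ⟨⟨i, rfl⟩, by simpa using hx⟩

theorem degree_hypercycle_inl (hk : 3 ≤ k) (hm : 2 ≤ m) (a : Fin m) :
    (hypercycle k m).degree (Sum.inl a) = 2 := by
  rw [degree_hypercycle hk]
  have : (Finset.univ.filter fun i => Sum.inl a ∈ cycleEdge k m i) = {a, (finRotate m).symm a} := by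
    ext i
    simp only [inl_mem_cycleEdge, Finset.mem_filter, Finset.mem_univ, true_and, Finset.mem_insert,
      Finset.mem_singleton, Equiv.eq_symm_apply, eq_comm]
  rw [this, Finset.card_pair]
  intro h
  exact finRotate_ne hm ((finRotate m).symm a) (by rw [Equiv.apply_symm_apply]; exact h)

theorem degree_hypercycle_inr (hk : 3 ≤ k) (a : Fin m) (j : Fin (k - 2)) :
    (hypercycle k m).degree (Sum.inr (a, j)) = 1 := by
  rw [degree_hypercycle hk]
  have : (Finset.univ.filter fun i => Sum.inr (a, j) ∈ cycleEdge k m i) = {a} := by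
    ext i
    simp [inr_mem_cycleEdge, eq_comm]
  rw [this, Finset.card_singleton]

theorem familyDegree_hypercycle [DecidableEq (hypercycle k m).vertexSet] (hk : 3 ≤ k) (hm : 2 ≤ m)
    (v : (hypercycle k m).vertexSet) : familyDegree (hypercycle k m).edgeFamily v = 1 ∨
      familyDegree (hypercycle k m).edgeFamily v = 2 := by
  rw [familyDegree_edgeFamily]
  rcases v with ⟨a | ⟨a, j⟩, _⟩
  · exact Or.inr (degree_hypercycle_inl hk hm a)
  · exact Or.inl (degree_hypercycle_inr hk a j)

theorem sum_familyDegree_hypercycle [DecidableEq (hypercycle k m).vertexSet] (hk : 3 ≤ k)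
    (hm : 2 ≤ m) : ∀ s ∈ (hypercycle k m).edgeFamily,
      ∑ v ∈ s, familyDegree (hypercycle k m).edgeFamily v = k + 2 := by
  intro s hs
  rw [mem_edgeFamily, edgeSet_hypercycle] at hs
  obtain ⟨i, hi⟩ := hs
  have hmap : s.map (Function.Embedding.subtype _) = cycleEdge k m i := by
    rw [← Finset.coe_inj, Finset.coe_map]
    exact hi.symm
  simp only [familyDegree_edgeFamily]
  have : ∑ v ∈ s, (hypercycle k m).degree v = ∑ x ∈ cycleEdge k m i, (hypercycle k m).degree x := by
    rw [← hmap, Finset.sum_map]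
    rfl
  rw [this, cycleEdge, Finset.sum_disjSum, Finset.sum_pair (finRotate_ne hm i).symm,
    degree_hypercycle_inl hk hm, degree_hypercycle_inl hk hm,
    Finset.sum_congr rfl fun x _ => degree_hypercycle_inr hk x.1 x.2]
  simp
  omega

end Hypergraph

/-! ### Recognition of the hypercycle -/

namespace Hypergraph

open RTensor

variable {β : Type*} {H : Hypergraph β} {k m : ℕ}

section

variable [Fintype H.vertexSet]

theorem finite_edges_containing (v : β) : {e ∈ H.edgeSet | v ∈ e}.Finite :=
  have := H.finite_edgeSet
  (Set.toFinite H.edgeSet).subset fun _ h => h.1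

theorem two_le_degree {v : β} {e f : Set β} (he : e ∈ H.edgeSet) (hf : f ∈ H.edgeSet) (hve : v ∈ e)
    (hvf : v ∈ f) (hef : e ≠ f) : 2 ≤ H.degree v := by
  rw [degree, ← Set.ncard_pair hef]
  refine Set.ncard_le_ncard ?_ (finite_edges_containing v)
  rintro _ (rfl | rfl)
  exacts [⟨he, hve⟩, ⟨hf, hvf⟩]

theorem eq_or_eq_of_degree_le_two {v : β} (hv : H.degree v ≤ 2) {e f g : Set β}
    (he : e ∈ H.edgeSet) (hf : f ∈ H.edgeSet) (hg : g ∈ H.edgeSet) (hve : v ∈ e) (hvf : v ∈ f)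
    (hvg : v ∈ g) (hef : e ≠ f) : g = e ∨ g = f := by
  have h : ({e, f} : Set (Set β)) = {e ∈ H.edgeSet | v ∈ e} := by
    refine Set.eq_of_subset_of_ncard_le ?_ ?_ (finite_edges_containing v)
    · rintro _ (rfl | rfl)
      exacts [⟨he, hve⟩, ⟨hf, hvf⟩]
    · rw [Set.ncard_pair hef]
      exact hv
  have : g ∈ ({e, f} : Set (Set β)) := h ▸ ⟨hg, hvg⟩
  exact this

/-- Three vertices of degree 2 would give the hyperedge degree sum at least 6 + (k - 3) = k + 3. -/
theorem eq_or_eq_of_degree_eq_two [DecidableEq H.vertexSet] (hu : H.IsUniform k)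
    (hdeg : ∀ v : H.vertexSet, 1 ≤ H.degree v)
    (hsum : ∀ s ∈ H.edgeFamily, ∑ v ∈ s, familyDegree H.edgeFamily v = k + 2)
    {e : Set β} (he : e ∈ H.edgeSet) {a b c : H.vertexSet} (ha : (a : β) ∈ e) (hb : (b : β) ∈ e)
    (hc : (c : β) ∈ e) (hab : a ≠ b) (ha2 : H.degree a = 2) (hb2 : H.degree b = 2)
    (hc2 : H.degree c = 2) : c = a ∨ c = b := by
  by_contra! hne
  obtain ⟨s, hs, rfl⟩ := exists_mem_edgeFamily he
  have hmem : ∀ {v : H.vertexSet}, (v : β) ∈ Subtype.val '' (s : Set H.vertexSet) → v ∈ s := by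
    rintro v ⟨w, hw, hwv⟩
    exact Subtype.ext hwv ▸ hw
  have h1 := hsum s hs
  simp only [familyDegree_edgeFamily] at h1
  have hsub : {c, a, b} ⊆ s := by
    intro x hx
    simp only [Finset.mem_insert, Finset.mem_singleton] at hx
    rcases hx with rfl | rfl | rfl
    exacts [hmem hc, hmem ha, hmem hb]
  have h3 : ({c, a, b} : Finset H.vertexSet).card = 3 := Finset.card_eq_three.2
    ⟨c, a, b, hne.1, hne.2, hab, rfl⟩
  have h4 := Finset.sum_sdiff (f := fun v : H.vertexSet => H.degree v) hsub
  have h5 : ∑ v ∈ ({c, a, b} : Finset H.vertexSet), H.degree v = 6 := by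
    have : ∀ v ∈ ({c, a, b} : Finset H.vertexSet), H.degree v = 2 := by
      intro x hx
      simp only [Finset.mem_insert, Finset.mem_singleton] at hx
      rcases hx with rfl | rfl | rfl
      exacts [hc2, ha2, hb2]
    rw [Finset.sum_congr rfl this, Finset.sum_const, h3]
    rfl
  have h6 := Finset.sum_le_sum fun v (_ : v ∈ s \ {c, a, b}) => hdeg v
  rw [← Finset.card_eq_sum_ones, Finset.card_sdiff_of_subset hsub, hu.card_eq s hs, h3] at h6
  have h7 := Finset.card_le_card hsub
  rw [h3, hu.card_eq s hs] at h7
  omega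

end

/-- A cycle of the incidence graph, read as a cyclic sequence of vertices and hyperedges. -/
theorem exists_cyclic_sequence {x : H.vertexSet ⊕ H.edgeSet} {c : H.incidenceGraph.Walk x x}
    (hc : c.IsCycle) : ∃ (l : ℕ) (u : Fin l → H.vertexSet) (f : Fin l → H.edgeSet), 2 ≤ l ∧
      Function.Injective u ∧ Function.Injective f ∧ (∀ i, (u i : β) ∈ (f i : Set β)) ∧
        ∀ i, (u (finRotate l i) : β) ∈ (f i : Set β) := by
  classical
  -- The cycle is rotated to start at a vertex; by bipartiteness, even positions are then vertices
  -- and odd positions hyperedges, and the length is even.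
  obtain ⟨u₀, c, hc⟩ : ∃ (u₀ : H.vertexSet) (c : H.incidenceGraph.Walk (Sum.inl u₀) (Sum.inl u₀)),
      c.IsCycle := by
    rcases x with u | e
    · exact ⟨u, c, hc⟩
    · have hadj := c.adj_snd hc.not_nil
      have hmem : c.snd ∈ c.support := c.getVert_mem_support 1
      rcases hs : c.snd with v | f
      · rw [hs] at hmem
        exact ⟨v, c.rotate _ hmem, hc.rotate hmem⟩
      · rw [hs] at hadj
        exact absurd hadj not_incidenceGraph_adj_inr_inr
  have hpar : ∀ i, (2 * i ≤ c.length → ∃ v, c.getVert (2 * i) = Sum.inl v) ∧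
      (2 * i + 1 ≤ c.length → ∃ e, c.getVert (2 * i + 1) = Sum.inr e) := by
    have hodd : ∀ i, (2 * i ≤ c.length → ∃ v, c.getVert (2 * i) = Sum.inl v) →
        2 * i + 1 ≤ c.length → ∃ e, c.getVert (2 * i + 1) = Sum.inr e := by
      intro i h hi
      obtain ⟨v, hv⟩ := h (by omega)
      have hadj := c.adj_getVert_succ (i := 2 * i) (by omega)
      rw [hv] at hadj
      rcases hs : c.getVert (2 * i + 1) with w | f
      · rw [hs] at hadj
        exact absurd hadj not_incidenceGraph_adj_inl_inl
      · exact ⟨f, rfl⟩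
    intro i
    induction i with
    | zero =>
      have h0 : 2 * 0 ≤ c.length → ∃ v, c.getVert (2 * 0) = Sum.inl v := fun _ => ⟨u₀, by simp⟩
      exact ⟨h0, hodd 0 h0⟩
    | succ i ih =>
      have h0 : 2 * (i + 1) ≤ c.length → ∃ v, c.getVert (2 * (i + 1)) = Sum.inl v := by
        intro hi
        obtain ⟨e, he⟩ := ih.2 (by omega)
        have hadj := c.adj_getVert_succ (i := 2 * i + 1) (by omega)
        rw [he] at hadj
        rcases hs : c.getVert (2 * (i + 1)) with w | f
        · exact ⟨w, rfl⟩
        · rw [show 2 * i + 1 + 1 = 2 * (i + 1) by ring, hs] at hadj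
          exact absurd hadj not_incidenceGraph_adj_inr_inr
      exact ⟨h0, hodd _ h0⟩
  have h3 := hc.three_le_length
  obtain ⟨n, hn⟩ : ∃ n, c.length = 2 * (n + 1) := by
    rcases Nat.even_or_odd' c.length with ⟨l, hl | hl⟩
    · exact ⟨l - 1, by omega⟩
    · obtain ⟨e, he⟩ := (hpar l).2 hl.ge
      rw [← hl, SimpleGraph.Walk.getVert_length] at he
      exact absurd he (by simp)
  choose u hu using fun i : Fin (n + 1) => (hpar i).1 (by omega)
  choose f hf using fun i : Fin (n + 1) => (hpar i).2 (by omega)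
  refine ⟨n + 1, u, f, by omega, ?_, ?_, ?_, ?_⟩
  · intro i j hij
    have := hc.getVert_injOn' (x₁ := 2 * i) (x₂ := 2 * j) (by simp only [Set.mem_ofPred_eq]; omega)
      (by simp only [Set.mem_ofPred_eq]; omega) (by rw [hu, hu, hij])
    omega
  · intro i j hij
    have := hc.getVert_injOn' (x₁ := 2 * i + 1) (x₂ := 2 * j + 1)
      (by simp only [Set.mem_ofPred_eq]; omega)
      (by simp only [Set.mem_ofPred_eq]; omega) (by rw [hf, hf, hij])
    omega
  · intro i
    have hadj := c.adj_getVert_succ (i := 2 * i) (by omega)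
    rw [hu, hf] at hadj
    exact incidenceGraph_adj_inl_inr.1 hadj
  · intro i
    have hadj := c.adj_getVert_succ (i := 2 * i + 1) (by omega)
    -- At the last index the walk is back at its start, matching the wrap-around of `finRotate` to
    -- 0.
    have hrot : c.getVert (2 * i + 1 + 1) = c.getVert (2 * (finRotate (n + 1) i : Fin (n + 1))) := by
      rw [coe_finRotate]
      split_ifs with h
      · rw [h, Fin.val_last, show 2 * n + 1 + 1 = c.length by omega]
        simp
      · rfl
    rw [hrot, hu, hf] at hadj
    exact incidenceGraph_adj_inr_inl.1 hadj

/-- The k - 2 vertices of each hyperedge off the cycle are private to it, since two hyperedges meet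
only in cycle vertices. Listing them gives an injective placement of the hypercycle, bijective
because the numbers of vertices agree. -/
theorem isIsomorphic_hypercycle_of_cyclic_sequence [Fintype H.vertexSet] (hk : 3 ≤ k) (hm : 2 ≤ m)
    (hu : H.IsUniform k) (hcard : Fintype.card H.vertexSet = m + m * (k - 2))
    {u : Fin m → H.vertexSet} {f : Fin m → H.edgeSet} (hui : Function.Injective u)
    (hfs : Function.Surjective f)
    (huf : ∀ i, (u i : β) ∈ (f i : Set β)) (huf' : ∀ i, (u (finRotate m i) : β) ∈ (f i : Set β))
    (hmeet : ∀ i j (v : H.vertexSet), i ≠ j → (v : β) ∈ (f i : Set β) → (v : β) ∈ (f j : Set β) →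
      v = u i ∨ v = u (finRotate m i)) :
    (hypercycle k m).IsIsomorphic H := by
  classical
  choose s hs hsf using fun i => exists_mem_edgeFamily (f i).2
  have hmem : ∀ i (v : H.vertexSet), v ∈ s i ↔ (v : β) ∈ (f i : Set β) := by
    intro i v
    rw [← hsf]
    simp
  have hW : ∀ i, ((s i).erase (u i)).erase (u (finRotate m i)) ⊆ s i := fun i =>
    (Finset.erase_subset _ _).trans (Finset.erase_subset _ _)
  have hWcard : ∀ i, (((s i).erase (u i)).erase (u (finRotate m i))).card = k - 2 := by
    intro i
    rw [Finset.card_erase_of_mem, Finset.card_erase_of_mem ((hmem i _).2 (huf i)),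
      hu.card_eq _ (hs i)]
    · omega
    · exact Finset.mem_erase.2 ⟨fun h => finRotate_ne hm i (hui h), (hmem i _).2 (huf' i)⟩
  let w : ∀ i, Fin (k - 2) ≃ ((s i).erase (u i)).erase (u (finRotate m i)) := fun i =>
    (Finset.equivFinOfCardEq (hWcard i)).symm
  have hw : ∀ i j, (((w i j : H.vertexSet)) : β) ∈ (f i : Set β) := fun i j =>
    (hmem i _).1 (hW i (w i j).2)
  have hwu : ∀ i j a, (w i j : H.vertexSet) ≠ u a := by
    intro i j a h
    have h1 := (w i j).2
    rw [Finset.mem_erase, Finset.mem_erase] at h1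
    have h2 : (u a : β) ∈ (f i : Set β) := h ▸ hw i j
    have h3 : i = a := by
      by_contra hia
      rcases hmeet i a (u a) hia h2 (huf a) with h4 | h4
      · exact hia (hui h4).symm
      · exact h1.1 (h.trans h4)
    exact h1.2.1 (h3 ▸ h)
  let place : Fin m ⊕ Fin m × Fin (k - 2) → H.vertexSet :=
    Sum.elim u fun p => (w p.1 p.2 : H.vertexSet)
  have hplace : Function.Injective place := by
    rintro (a | ⟨a, p⟩) (b | ⟨b, q⟩) h
    · exact congrArg _ (hui h)
    · exact absurd h.symm (hwu b q a)
    · exact absurd h (hwu a p b)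
    · have h' : (w a p : H.vertexSet) = w b q := h
      obtain rfl : a = b := by
        by_contra hab
        rcases hmeet a b (w a p) hab (hw a p) (h' ▸ hw b q) with h1 | h1
        · exact hwu _ _ _ h1
        · exact hwu _ _ _ h1
      rw [(w a).injective (Subtype.ext h')]
  have hbij : Function.Bijective place := (Fintype.bijective_iff_injective_and_card place).2 ⟨hplace, by
    rw [hcard]; simp⟩
  have hinj : Function.Injective fun x => (place x : β) := Subtype.val_injective.comp hplace
  have himage : ∀ i, (fun x => (place x : β)) '' (cycleEdge k m i) = f i := by
    intro i
    have hfin : (f i : Set β).Finite := by rw [← hsf]; exact Set.toFinite _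
    refine Set.eq_of_subset_of_ncard_le ?_ ?_ hfin
    · rintro _ ⟨a | ⟨a, p⟩, hx, rfl⟩
      · rcases inl_mem_cycleEdge.1 hx with rfl | rfl
        exacts [huf _, huf' _]
      · obtain rfl := inr_mem_cycleEdge.1 hx
        exact hw _ _
    · rw [Set.ncard_image_of_injective _ hinj, Set.ncard_coe_finset,
        card_cycleEdge (by omega) hm, hu _ (f i).2]
  have hbij' : Function.Bijective fun x : (hypercycle k m).vertexSet => place x.1 :=
    hbij.comp ⟨Subtype.val_injective, fun x => ⟨⟨x, trivial⟩, rfl⟩⟩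
  refine ⟨Equiv.ofBijective _ hbij', fun e => ?_⟩
  have himg : Subtype.val '' (Equiv.ofBijective _ hbij' '' e) =
      (fun x => (place x : β)) '' (Subtype.val '' e) := by
    rw [Set.image_image, Set.image_image]
    rfl
  rw [himg, edgeSet_hypercycle]
  constructor
  · rintro ⟨i, hi⟩
    rw [← hi, himage]
    exact (f i).2
  · intro he
    obtain ⟨i, hi⟩ := hfs ⟨_, he⟩
    refine ⟨i, Set.image_injective.2 hinj ?_⟩
    rw [himage, hi]

/-- A linear unicyclic hypergraph with vertex degrees `1` and `2` and degree sum `k + 2` in each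
hyperedge is a hypercycle. -/
theorem IsLinearUnicyclic.isIsomorphic_hypercycle [Fintype H.vertexSet] [DecidableEq H.vertexSet]
    (hk : 3 ≤ k) (h : H.IsLinearUnicyclic k m)
    (hcard : Fintype.card H.vertexSet = m + m * (k - 2))
    (hdeg : ∀ v : H.vertexSet, familyDegree H.edgeFamily v = 1 ∨ familyDegree H.edgeFamily v = 2)
    (hsum : ∀ s ∈ H.edgeFamily, ∑ v ∈ s, familyDegree H.edgeFamily v = k + 2) :
    (hypercycle k m).IsIsomorphic H := by
  simp only [familyDegree_edgeFamily] at hdeg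
  have hdeg1 : ∀ v : H.vertexSet, 1 ≤ H.degree v := fun v => by
    have := hdeg v
    omega
  have hdeg2 : ∀ v : H.vertexSet, H.degree v ≤ 2 := fun v => by
    have := hdeg v
    omega
  obtain ⟨C, ⟨x, c, hc, -⟩, -⟩ := h.unicyclic.2
  obtain ⟨l, u, f, hl, hui, hfi, huf, huf'⟩ := exists_cyclic_sequence hc
  have hrot := fun i => finRotate_ne hl i
  have hne : ∀ i, (f i : Set β) ≠ f (finRotate l i) := fun i h' =>
    hrot i (hfi (Subtype.ext h')).symm
  -- A vertex of the cycle lies in two consecutive, different hyperedges.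
  have hu2' : ∀ i, H.degree (u (finRotate l i)) = 2 := fun i =>
    le_antisymm (hdeg2 _) (two_le_degree (f i).2 (f (finRotate l i)).2 (huf' i) (huf _) (hne i))
  have hu2 : ∀ i, H.degree (u i) = 2 := fun i => by
    have := hu2' ((finRotate l).symm i)
    rwa [Equiv.apply_symm_apply] at this
  have hmeet : ∀ i (e : H.edgeSet) (v : H.vertexSet), f i ≠ e → (v : β) ∈ (f i : Set β) →
      (v : β) ∈ (e : Set β) → v = u i ∨ v = u (finRotate l i) := by
    intro i e v hie hvi hve
    exact eq_or_eq_of_degree_eq_two h.uniform hdeg1 hsum (f i).2 (huf i) (huf' i) hvi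
      (fun h' => hrot i (hui h').symm) (hu2 i) (hu2' i) (le_antisymm (hdeg2 _)
        (two_le_degree (f i).2 e.2 hvi hve fun h' => hie (Subtype.ext h')))
  -- A hyperedge meeting the cycle meets it in a cycle vertex, whose two hyperedges are already on
  -- the cycle.
  have hclosed : ∀ i (e : H.edgeSet) (v : H.vertexSet), (v : β) ∈ (f i : Set β) →
      (v : β) ∈ (e : Set β) → e ∈ Set.range f := by
    intro i e v hvi hve
    by_cases hie : f i = e
    · exact ⟨i, hie⟩
    have hrot2 : ∀ j, v = u (finRotate l j) → e ∈ Set.range f := by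
      rintro j rfl
      rcases eq_or_eq_of_degree_le_two (hdeg2 _) (f j).2 (f (finRotate l j)).2 e.2 (huf' j)
        (huf _) hve (hne j) with h' | h'
      · exact ⟨j, Subtype.ext h'.symm⟩
      · exact ⟨finRotate l j, Subtype.ext h'.symm⟩
    rcases hmeet i e v hie hvi hve with h' | h'
    · exact hrot2 ((finRotate l).symm i) (by rwa [Equiv.apply_symm_apply])
    · exact hrot2 i h'
  have hnonempty : ∀ e ∈ H.edgeSet, e.Nonempty := fun e he => by
    rw [Set.nonempty_iff_ne_empty]
    rintro rfl
    have := h.uniform _ he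
    simp at this
    omega
  have hfs : Function.Surjective f := by
    -- Being on the cycle propagates along walks of the incidence graph, so connectedness puts every
    -- hyperedge on it.
    let P : H.vertexSet ⊕ H.edgeSet → Prop :=
      Sum.elim (fun v => ∃ i, (v : β) ∈ (f i : Set β)) fun e => e ∈ Set.range f
    have hP : ∀ {a b : H.vertexSet ⊕ H.edgeSet}, H.incidenceGraph.Walk a b → P a → P b := by
      intro a b p
      induction p with
      | nil => exact id
      | @cons a b _ hadj _ ih =>
        intro ha
        refine ih ?_
        rcases a with v | e <;> rcases b with w | e'
        · exact absurd hadj not_incidenceGraph_adj_inl_inl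
        · obtain ⟨i, hi⟩ := ha
          exact hclosed i e' v hi (incidenceGraph_adj_inl_inr.1 hadj)
        · obtain ⟨i, rfl⟩ := ha
          exact ⟨i, incidenceGraph_adj_inr_inl.1 hadj⟩
        · exact absurd hadj not_incidenceGraph_adj_inr_inr
    intro e
    obtain ⟨p⟩ := (h.unicyclic.1.incidenceGraph_connected hnonempty).preconnected
      (Sum.inr (f ⟨0, by omega⟩)) (Sum.inr e)
    exact hP p ⟨_, rfl⟩
  obtain rfl : l = m := by
    rw [← h.ncard_edgeSet, ← Nat.card_coe_set_eq, ← Nat.card_congr (Equiv.ofBijective f ⟨hfi, hfs⟩),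
      Nat.card_eq_fintype_card, Fintype.card_fin]
  exact isIsomorphic_hypercycle_of_cyclic_sequence hk hl h.uniform hcard hui hfs huf huf'
    fun i j v hij hvi hvj => hmeet i (f j) v (fun h' => hij (hfi h')) hvi hvj

end Hypergraph

/-! ### Comparison of a linear unicyclic hypergraph with the hypercycle -/

namespace Hypergraph

open RTensor

variable {β : Type*} {H : Hypergraph β} [Fintype H.vertexSet] {k m : ℕ}

theorem IsLinearUnicyclic.card_vertexSet (hk : 3 ≤ k) (h : H.IsLinearUnicyclic k m) :
    Fintype.card H.vertexSet = m + m * (k - 2) := by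
  have h1 := (h.unicyclic.1.isUnicyclic_iff (by omega : 1 ≤ k) h.uniform).1 h.unicyclic
  rw [h.ncard_edgeSet, Nat.card_eq_fintype_card] at h1
  obtain ⟨l, rfl⟩ : ∃ l, k = l + 2 := ⟨k - 2, by omega⟩
  rw [Nat.add_sub_cancel]
  linarith [h1, mul_add m l 2]

/-- The deciding orders 2 and k + 2 lie in the range of moments that the order inspects; the number
of vertices alone exceeds k + 2. -/
theorem add_two_lt_card_mul (hk : 3 ≤ k) (hm : 3 ≤ m)
    (hcard : Fintype.card H.vertexSet = m + m * (k - 2)) :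
    k + 2 < Fintype.card H.vertexSet * (k - 1) ^ (Fintype.card H.vertexSet - 1) := by
  obtain ⟨l, rfl⟩ : ∃ l, k = l + 3 := ⟨k - 3, by omega⟩
  have h1 : 3 + 3 * (l + 1) ≤ Fintype.card H.vertexSet := by
    rw [hcard, show l + 3 - 2 = l + 1 by omega]
    exact Nat.add_le_add hm (Nat.mul_le_mul_right _ hm)
  have h2 : l + 6 ≤ Fintype.card H.vertexSet := by omega
  have h3 : 1 ≤ (l + 3 - 1) ^ (Fintype.card H.vertexSet - 1) := Nat.one_le_pow _ _ (by omega)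
  calc l + 3 + 2 < Fintype.card H.vertexSet * 1 := by omega
    _ ≤ _ := Nat.mul_le_mul_left _ h3

/-- A linear unicyclic hypergraph comes after the hypercycle or is isomorphic to it. -/
theorem IsLinearUnicyclic.exists_moment_lt_or_isIsomorphic (hk : 3 ≤ k) (hm : 3 ≤ m)
    {α : ℝ} (hα₀ : 0 < α) (hα₁ : α < 1) (h : H.IsLinearUnicyclic k m) :
    (∃ d, (d = 2 ∨ d = k + 2) ∧
      (∀ t < d, (hypercycle k m).alphaMoment k α t = H.alphaMoment k α t) ∧
        (hypercycle k m).alphaMoment k α d < H.alphaMoment k α d) ∨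
      (hypercycle k m).IsIsomorphic H := by
  classical
  have hC := isLinearUnicyclic_hypercycle hk hm
  -- Any bijection will do: it moves the hypercycle to the vertex set of H, so that both traces are
  -- given by the same constants.
  let ψ : (hypercycle k m).vertexSet ≃ H.vertexSet :=
    Fintype.equivOfCardEq ((hC.card_vertexSet hk).trans (h.card_vertexSet hk).symm)
  let μ : Finset (hypercycle k m).vertexSet ↪ Finset H.vertexSet :=
    (Finset.mapEmbedding ψ.toEmbedding).toEmbedding
  have hμ : ∀ s, μ s = s.map ψ.toEmbedding := fun _ => rfl
  set F := (hypercycle k m).edgeFamily.map μ with hF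
  have hmem : ∀ s, s ∈ (hypercycle k m).edgeFamily ↔ s.map ψ.toEmbedding ∈ F := fun s => by
    rw [← hμ, hF, Finset.mem_map' μ]
  have hdeg : ∀ v, familyDegree F (ψ v) = familyDegree (hypercycle k m).edgeFamily v := by
    intro v
    rw [familyDegree, familyDegree, hF, Finset.filter_map, Finset.card_map]
    congr 1
    ext s
    simp [hμ]
  have hmoment : ∀ t, (hypercycle k m).alphaMoment k α t = (familyTensor F k α).trace t := by
    intro t
    rw [alphaMoment_eq_trace, ← trace_reindex ψ, ← familyTensor_comp ψ hmem]
  have hFall : ∀ s ∈ F, ∃ s' ∈ (hypercycle k m).edgeFamily, s'.map ψ.toEmbedding = s := by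
    intro s hs
    obtain ⟨s', hs', rfl⟩ := Finset.mem_map.1 hs
    exact ⟨s', hs', rfl⟩
  have hne : ∀ e ∈ H.edgeSet, e.Nonempty := fun e he => by
    rw [Set.nonempty_iff_ne_empty]
    rintro rfl
    have := h.uniform _ he
    simp at this
    omega
  have hne' : H.edgeSet.Nonempty := by
    rw [Set.nonempty_iff_ne_empty]
    intro h0
    have := h.ncard_edgeSet
    rw [h0, Set.ncard_empty] at this
    omega
  have key := trace_familyTensor_lt_or (E := H.edgeFamily) (F := F) hk hα₀ hα₁ h.uniform.card_eq
    h.linear.card_inter_le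
  refine (key ?_ ?_ ?_ ?_ ?_ ?_).imp ?_ fun ⟨h1, h2⟩ =>
    h.isIsomorphic_hypercycle hk (h.card_vertexSet hk) h1 h2
  · intro s hs
    obtain ⟨s, hs', rfl⟩ := hFall s hs
    rw [Finset.card_map, hC.uniform.card_eq s hs']
  · intro s hs t ht hst
    obtain ⟨s, hs', rfl⟩ := hFall s hs
    obtain ⟨t, ht', rfl⟩ := hFall t ht
    rw [← Finset.map_inter, Finset.card_map]
    exact hC.linear.card_inter_le s hs' t ht' fun h' => hst (by rw [h'])
  · rw [hF, Finset.card_map, card_edgeFamily, card_edgeFamily, h.ncard_edgeSet, hC.ncard_edgeSet]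
  · intro v
    rw [familyDegree_edgeFamily]
    exact h.unicyclic.one_le_degree hne' hne v
  · intro v
    rw [← ψ.apply_symm_apply v, hdeg]
    exact familyDegree_hypercycle hk (by omega) _
  · intro s hs
    obtain ⟨s, hs', rfl⟩ := hFall s hs
    rw [Finset.sum_map]
    simp only [Equiv.coe_toEmbedding, hdeg]
    exact sum_familyDegree_hypercycle hk (by omega) s hs'
  · rintro ⟨d, hd, h1, h2⟩
    refine ⟨d, hd, fun t ht => ?_, ?_⟩
    · rw [hmoment, alphaMoment_eq_trace, h1 t ht]
    · rw [hmoment, alphaMoment_eq_trace]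
      exact h2

end Hypergraph

theorem mainTheorem11 (k m : ℕ) (hk : 3 ≤ k) (hm : 3 ≤ m) (α : ℝ) (hα₀ : 0 < α) (hα₁ : α < 1) :
    (Hypergraph.hypercycle k m).IsLinearUnicyclic k m ∧
      ∀ {β : Type*} (H : Hypergraph β) [Fintype H.vertexSet], H.IsLinearUnicyclic k m →
        Hypergraph.AlphaBeforeOrEq k α (Hypergraph.hypercycle k m) H ∧
          (Hypergraph.AlphaEq k α (Hypergraph.hypercycle k m) H ↔
            (Hypergraph.hypercycle k m).IsIsomorphic H) := by
  have hC := Hypergraph.isLinearUnicyclic_hypercycle hk hm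
  refine ⟨hC, fun {β} H _ h => ?_⟩
  have hlt := Hypergraph.add_two_lt_card_mul hk hm (hC.card_vertexSet hk)
  rcases h.exists_moment_lt_or_isIsomorphic hk hm hα₀ hα₁ with ⟨d, hd, h1, h2⟩ | hiso
  · have hdlt : d < _ := lt_of_le_of_lt (by omega : d ≤ k + 2) hlt
    have hbefore : Hypergraph.AlphaBefore k α (Hypergraph.hypercycle k m) H :=
      ⟨(hC.card_vertexSet hk).trans (h.card_vertexSet hk).symm, d,
        ⟨by omega, Nat.le_sub_one_of_lt hdlt⟩, h1, h2⟩
    have hneq : ¬ Hypergraph.AlphaEq k α (Hypergraph.hypercycle k m) H := fun heq =>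
      h2.ne (heq.2 d hdlt)
    exact ⟨Or.inl hbefore, fun heq => absurd heq hneq, fun hiso => absurd (hiso.alphaEq k α) hneq⟩
  · exact ⟨Or.inr (hiso.alphaEq k α), fun _ => hiso, fun _ => hiso.alphaEq k α⟩
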